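/- **Setting.** Consider a Gaussian linear bandit with $K\ge 2$ arms: arm $i\in[K]$ has a feature vector $a_i\in\mathbb R^d$ and reward law $\mathcal N(m_i,\sigma_i^2)$, $m_i=a_i^\top\theta$, $\sigma_i>0$, with a unique best arm $I^*$. Let $\mathcal X=[K]\setminus\{I^*\}$, and let $\Delta_K,\Delta_{\mathcal X}$ be the probability simplices. For $x\in\mathcal X$ and $p\in\mathbb R^K_{\ge0}$ put $$D(p,x)=\inf\Bigl\{\sum_i p_i\,\mathrm{KL}\bigl(\mathcal N(a_i^\top\theta,\sigma_i^2)\,\|\,\mathcal N(a_i^\top\vartheta,\sigma_i^2)\bigr):\ a_{I^*}^\top\vartheta<a_x^\top\vartheta\Bigr\},\qquad F(p,\mu)=\sum_{x\in\mathcal X}\mu_xD(p,x).$$ Let $\mathcal D_F\subset\Delta_K\times\Delta_{\mathcal X}$ be the set of points where $F$ is differentiable (relative to $\mathbb R^K_{\ge 0}$ in $p$), let $\partial_p^\circ F(p,\mu)$ be the convex hull of all limits $\lim_n\nabla_pF(p^n,\mu^n)$ with $\mathcal D_F\ni(p^n,\mu^n)\to(p,\mu)$, and let $$\mathrm{LMO}_p(p,\mu)=\mathrm{conv}\bigl\{q\in\Delta_K:\exists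 f\in\partial_p^\circ F(p,\mu),\ q\in\arg\max_{q'\in\Delta_K}q'^\top f\bigr\},\qquad \mathrm{LMO}_\mu(p,\mu)=\arg\min_{\nu\in\Delta_{\mathcal X}}\nu^\top\nabla_\mu F(p,\mu).$$ A *solution* is a locally absolutely continuous $(p,\mu):[0,\infty)\to\Delta_K\times\Delta_{\mathcal X}$ with $\dot p\in\mathrm{LMO}_p(p,\mu)-p$ and $\dot\mu\in\mathrm{LMO}_\mu(p,\mu)-\mu$ for almost every $t$; its initial condition in $\Delta_K\times\Delta_{\mathcal X}$ is arbitrary. Put $\delta_x=a_{I^*}-a_x$, $\mathcal H=\mathrm{span}\{a_i\}$, $\mathcal S_p=\mathrm{span}\{a_i:p_i>0\}$, $\mathcal Z(p)=\{x:D(p,x)=0\}$. For a subspace $\mathcal S\subsetneq\mathcal H$ spanned by arms let $O(\mathcal S)=\{j:a_j\notin\mathcal S\}$, $$\gamma(\mathcal S)=\min_{u\in\mathcal S^\perp\cap\mathcal H,\ \|u\|=1}\ \max_{j\in O(\mathcal S)}\frac{(a_j^\top u)^2}{\sigma_j^{2}},\qquad \rho(\mathcal S)=\max_{x\in\mathcal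 X}\|\mathrm{Proj}_{\mathcal S^\perp}\delta_x\|^2,\qquad m(\mathcal S)=\frac{\min_{x\in\mathcal X}(m_{I^*}-m_x)^2}{2}\,\frac{\gamma(\mathcal S)}{\rho(\mathcal S)}.$$ For a constant $M_p$ with $\|\nabla_pD(p,x)\|_\infty\le M_p$ for all $x\in\mathcal X$ and all $p\in\Delta_K$ at which $D(\cdot,x)$ is differentiable, let $$\varepsilon_{\mathcal S}=\min\Bigl\{\frac12,\ \frac{m(\mathcal S)}{4\,|O(\mathcal S)|\,M_p}\Bigr\},\qquad T_{\mathcal S}=\log(1/\varepsilon_{\mathcal S}).$$ **Theorem.** Such a finite $M_p$ exists, and for every such $M_p$ the following holds. For every solution there are $r\ge0$, a strictly increasing chain $$\mathcal S_{p(0)}=\mathcal S_0\subsetneq\mathcal S_1\subsetneq\cdots\subsetneq\mathcal S_r=\mathcal H,\qquad r\le\mathrm{rank}\{\delta_x:x\in\mathcal X\}\le\dim\mathcal H,$$ with $r=0$ if and only if $\mathcal Z(p(0))=\varnothing$, and times $0=\tau_0\le\tau_1<\tau_2<\cdots<\tau_r$ such that for each $\ell<r$: (i) $\mathcal S_{p(t)}=\mathcal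 S_\ell$ and $\mathcal Z(p(t))\ne\varnothing$ for $t\in(\tau_\ell,\tau_{\ell+1}]$ (and for $t=0$ if $\ell=0$), while $\mathcal S_{p(t)}=\mathcal H$ for $t>\tau_r$; (ii) $\tau_{\ell+1}-\tau_\ell\le T_{\mathcal S_\ell}+\log2$. Consequently, for all $t\ge T^*:=\sum_{\ell=0}^{r-1}(T_{\mathcal S_\ell}+\log 2)$ we have $\mathcal S_{p(t)}=\mathcal H$, $\mathcal Z(p(t))=\varnothing$, i.e. $D(p(t),x)>0$ for all $x\in\mathcal X$, and $F$ is differentiable at $(p(t),\mu(t))$. The times $T^*$ are bounded by a constant that does not depend on the solution. Finally, the game has a Nash equilibrium $(p^*,\mu^*)$, and with $F^*=F(p^*,\mu^*)$ the game value converges uniformly: for every $\varepsilon>0$ there is $T$ such that $|F(p(t),\mu(t))-F^*|\le\varepsilon$ for every solution and every $t\ge T$. -/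

import Mathlib

open Set Filter Topology MeasureTheory ProbabilityTheory
open scoped NNReal ENNReal

/-- A Gaussian linear bandit with `K` arms and a unique best arm: arm `i` has feature vector `a i`,
and pulling it gives a reward with law `𝒩(⟨a i, θ⟩, σ i ^ 2)`. -/
structure LinearBandit (K d : ℕ) where
  /-- feature vectors -/
  a : Fin K → EuclideanSpace ℝ (Fin d)
  /-- true parameter -/
  θ : EuclideanSpace ℝ (Fin d)
  /-- standard deviations of the noise -/
  σ : Fin K → ℝ≥0
  σ_pos : ∀ i, 0 < σ i
  /-- the best arm -/
  best : Fin K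
  best_unique : ∀ x, x ≠ best → inner ℝ (a x) θ < inner ℝ (a best) θ

namespace LinearBandit

noncomputable section

variable {K d : ℕ} (B : LinearBandit K d)

/-- Confusing scenarios: the arms other than the best one. -/
abbrev Scenario : Type := {x : Fin K // x ≠ B.best}

/-- Law of a reward of arm `i` under the parameter `ϑ`. -/
def armLaw (ϑ : EuclideanSpace ℝ (Fin d)) (i : Fin K) : Measure ℝ :=
  gaussianReal (inner ℝ (B.a i) ϑ) (B.σ i ^ 2)

/-- Parameters under which arm `x` beats the true best arm. -/
def alt (x : B.Scenario) : Set (EuclideanSpace ℝ (Fin d)) :=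
  {ϑ | inner ℝ (B.a B.best) ϑ < inner ℝ (B.a x) ϑ}

/-- `Γ(p, ϑ) = ∑ i, p i * KL(P_{θ,i} ‖ P_{ϑ,i})`. -/
def info (p : Fin K → ℝ) (ϑ : EuclideanSpace ℝ (Fin d)) : ℝ :=
  ∑ i, p i * (InformationTheory.klDiv (B.armLaw B.θ i) (B.armLaw ϑ i)).toReal

/-- `D(p, x) = inf_{ϑ ∈ Alt_x} Γ(p, ϑ)`. It is only used on the nonnegative orthant. -/
def D (p : Fin K → ℝ) (x : B.Scenario) : ℝ :=
  sInf (B.info p '' B.alt x)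

/-- Mixed payoff `F(p, μ) = ∑ x, μ x * D(p, x)`. -/
def F (p : Fin K → ℝ) (μ : B.Scenario → ℝ) : ℝ :=
  ∑ x, μ x * B.D p x

/-- The nonnegative orthant, the domain of the payoffs `D(·, x)`. -/
def orthant (K : ℕ) : Set (Fin K → ℝ) := {p | ∀ i, 0 ≤ p i}

/-- The points of `Δ_K × Δ_𝒳` at which `F` is differentiable (relative to the orthant in `p`). -/
def diffSet : Set ((Fin K → ℝ) × (B.Scenario → ℝ)) :=
  {z | z.1 ∈ stdSimplex ℝ (Fin K) ∧ z.2 ∈ stdSimplex ℝ B.Scenario ∧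
    DifferentiableWithinAt ℝ (fun w : (Fin K → ℝ) × (B.Scenario → ℝ) => B.F w.1 w.2)
      (orthant K ×ˢ univ) z}

/-- The gradient of `F` in `p`. -/
def gradP (p : Fin K → ℝ) (μ : B.Scenario → ℝ) : Fin K → ℝ :=
  fun i => fderivWithin ℝ (fun q => B.F q μ) (orthant K) p (Pi.single i 1)

/-- The gradient of `F` in `μ`. -/
def gradMu (p : Fin K → ℝ) (μ : B.Scenario → ℝ) : B.Scenario → ℝ :=
  fun x => fderiv ℝ (fun ν => B.F p ν) μ (Pi.single x 1)

/-- The Clarke generalized gradient of `F` in `p`. -/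
def clarkeP (p : Fin K → ℝ) (μ : B.Scenario → ℝ) : Set (Fin K → ℝ) :=
  convexHull ℝ {f | ∃ z : ℕ → (Fin K → ℝ) × (B.Scenario → ℝ),
    (∀ n, z n ∈ B.diffSet) ∧ Tendsto z atTop (𝓝 (p, μ)) ∧
    Tendsto (fun n => B.gradP (z n).1 (z n).2) atTop (𝓝 f)}

/-- Linear oracle of the maximizing player. -/
def LMOp (p : Fin K → ℝ) (μ : B.Scenario → ℝ) : Set (Fin K → ℝ) :=
  convexHull ℝ {q | q ∈ stdSimplex ℝ (Fin K) ∧ ∃ f ∈ B.clarkeP p μ,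
    ∀ q' ∈ stdSimplex ℝ (Fin K), ∑ i, q' i * f i ≤ ∑ i, q i * f i}

/-- Linear oracle of the minimizing player. -/
def LMOmu (p : Fin K → ℝ) (μ : B.Scenario → ℝ) : Set (B.Scenario → ℝ) :=
  {ν | ν ∈ stdSimplex ℝ B.Scenario ∧ ∀ ν' ∈ stdSimplex ℝ B.Scenario,
    ∑ x, ν x * B.gradMu p μ x ≤ ∑ x, ν' x * B.gradMu p μ x}

/-- `(p, μ)` is an absolutely continuous solution on `[0, ∞)`, with values in `Δ_K × Δ_𝒳`, of the
differential inclusion `p' ∈ LMOp(p, μ) - p`, `μ' ∈ LMOmu(p, μ) - μ`. -/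
structure IsSolution (p : ℝ → Fin K → ℝ) (μ : ℝ → B.Scenario → ℝ) : Prop where
  mem_p : ∀ t, 0 ≤ t → p t ∈ stdSimplex ℝ (Fin K)
  mem_mu : ∀ t, 0 ≤ t → μ t ∈ stdSimplex ℝ B.Scenario
  ac_p : ∀ T, 0 < T → AbsolutelyContinuousOnInterval p 0 T
  ac_mu : ∀ T, 0 < T → AbsolutelyContinuousOnInterval μ 0 T
  inclusion : ∀ᵐ t ∂(volume.restrict (Ioi (0 : ℝ))),
    ∃ q ∈ B.LMOp (p t) (μ t), ∃ ν ∈ B.LMOmu (p t) (μ t),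
      HasDerivAt p (q - p t) t ∧ HasDerivAt μ (ν - μ t) t

/-- Nash equilibrium of the game on `Δ_K × Δ_𝒳` with payoff `F`. -/
def IsNash (p : Fin K → ℝ) (μ : B.Scenario → ℝ) : Prop :=
  p ∈ stdSimplex ℝ (Fin K) ∧ μ ∈ stdSimplex ℝ B.Scenario ∧
  (∀ q ∈ stdSimplex ℝ (Fin K), B.F q μ ≤ B.F p μ) ∧
  (∀ ν ∈ stdSimplex ℝ B.Scenario, B.F p μ ≤ B.F p ν)

/-- `M` bounds the partial derivatives of all `D(·, x)` at all points of differentiability. -/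
def IsGradientBound (M : ℝ) : Prop :=
  ∀ x : B.Scenario, ∀ p ∈ stdSimplex ℝ (Fin K),
    DifferentiableWithinAt ℝ (fun q => B.D q x) (orthant K) p →
    ∀ i, |fderivWithin ℝ (fun q => B.D q x) (orthant K) p (Pi.single i 1)| ≤ M

/-- `δ_x = a_{I*} - a_x`. -/
def delta (x : B.Scenario) : EuclideanSpace ℝ (Fin d) := B.a B.best - B.a x

/-- The span `ℋ` of all features. -/
def fullSpan : Submodule ℝ (EuclideanSpace ℝ (Fin d)) := Submodule.span ℝ (range B.a)

/-- The active feature span `𝒮_p`. -/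
def activeSpan (p : Fin K → ℝ) : Submodule ℝ (EuclideanSpace ℝ (Fin d)) :=
  Submodule.span ℝ (B.a '' {i | 0 < p i})

/-- The zero-information scenarios `𝒵(p)`. -/
def zeroInfo (p : Fin K → ℝ) : Set B.Scenario := {x | B.D p x = 0}

/-- The arms `O(S)` whose features lie outside `S`. -/
abbrev Outside (S : Submodule ℝ (EuclideanSpace ℝ (Fin d))) : Type := {j : Fin K // B.a j ∉ S}

/-- The smallest gap between the mean of the best arm and that of another arm. -/
def gapMin : ℝ := ⨅ x : B.Scenario, (inner ℝ (B.a B.best) B.θ - inner ℝ (B.a x) B.θ)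

/-- `γ(S)`: minimum over unit vectors `u ∈ Sᗮ ∩ ℋ` of `max_{j ∈ O(S)} σ_j⁻² ⟨a_j, u⟩²`. -/
def gam (S : Submodule ℝ (EuclideanSpace ℝ (Fin d))) : ℝ :=
  ⨅ u : {u : EuclideanSpace ℝ (Fin d) // u ∈ Sᗮ ⊓ B.fullSpan ∧ ‖u‖ = 1},
    ⨆ j : B.Outside S, (inner ℝ (B.a j) (u : EuclideanSpace ℝ (Fin d))) ^ 2 / (B.σ j : ℝ) ^ 2

/-- `ρ(S)`: maximum over `x` of the squared norm of the projection of `δ_x` to `Sᗮ`. -/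
def rho (S : Submodule ℝ (EuclideanSpace ℝ (Fin d))) : ℝ :=
  ⨆ x : B.Scenario, ‖Sᗮ.starProjection (B.delta x)‖ ^ 2

/-- `m(S) = (gapMin² / 2) * γ(S) / ρ(S)`. -/
def mconst (S : Submodule ℝ (EuclideanSpace ℝ (Fin d))) : ℝ :=
  B.gapMin ^ 2 / 2 * (B.gam S / B.rho S)

/-- `ε_S = min {1/2, m(S) / (4 |O(S)| M)}`. -/
def epsS (M : ℝ) (S : Submodule ℝ (EuclideanSpace ℝ (Fin d))) : ℝ :=
  min (1 / 2) (B.mconst S / (4 * (Nat.card (B.Outside S) : ℝ) * M))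

/-- `T_S = log (1 / ε_S)`. -/
def timeS (M : ℝ) (S : Submodule ℝ (EuclideanSpace ℝ (Fin d))) : ℝ :=
  Real.log (1 / B.epsS M S)

/-- `T* = ∑_{ℓ < r} (T_{S_ℓ} + log 2)`. -/
def timeStar (M : ℝ) (r : ℕ) (S : ℕ → Submodule ℝ (EuclideanSpace ℝ (Fin d))) : ℝ :=
  ∑ l ∈ Finset.range r, (B.timeS M (S l) + Real.log 2)

end

end LinearBandit

/-!
In the coordinates `y i = ⟪a i, θ - ϑ⟫ / (√2 σ i)` the information `D p x` is the least energy
`∑ i, p i * y i ^ 2` over an affine subspace, and by Danskin's formula its supergradients are the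
squares of the minimizers. Limits of minimizers at positive weights stay bounded however `p`
degenerates, which gives `M_p` and describes the Clarke gradient.

The weights decay no faster than `e ^ (-t)`, so active arms stay active and the span of the active
arms increases. While it is not full, the oracle for `μ` avoids every scenario of positive
information, whose total mass therefore decays like `e ^ (-t)`. Once this mass is below `ε_S`, the
gradient is small on the arms inside the span, while a scenario without information forces a large
entry outside it; the oracle for `p` then activates a new arm. By continuity of the weights the arms
active at a time are already active shortly before it, so the span is left continuous.

When the span is full, all minimizers are unique and locally Lipschitz in `p`. Along the dynamics
the derivative of the duality gap is at most minus the gap: the replies contribute exactly minus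
the gap, and the curvature term has a sign by the concavity of `D`. The gap bounds the distance of
the payoff to the value of the game, which exists by Sion's minimax theorem.
-/

open scoped Matrix

theorem gaussianReal_eq_withDensity_exp (m₁ m₂ : ℝ) {v : ℝ≥0} (hv : v ≠ 0) :
    gaussianReal m₁ v = (gaussianReal m₂ v).withDensity fun x =>
      ENNReal.ofReal (Real.exp ((m₁ - m₂) * (2 * x - m₁ - m₂) / (2 * v))) := by
  rw [gaussianReal_of_var_ne_zero _ hv, gaussianReal_of_var_ne_zero _ hv,
    ← withDensity_mul _ (measurable_gaussianPDF _ _) (by fun_prop)]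
  congr 1
  ext x
  rw [Pi.mul_apply, gaussianPDF, gaussianPDF, ← ENNReal.ofReal_mul (gaussianPDFReal_nonneg _ _ _),
    gaussianPDFReal, gaussianPDFReal, mul_assoc _ (Real.exp _) (Real.exp _), ← Real.exp_add]
  congr 3
  field_simp
  ring

theorem absolutelyContinuous_gaussianReal (m₁ m₂ : ℝ) {v : ℝ≥0} (hv : v ≠ 0) :
    gaussianReal m₁ v ≪ gaussianReal m₂ v :=
  (gaussianReal_absolutelyContinuous m₁ hv).trans (gaussianReal_absolutelyContinuous' m₂ hv)

theorem llr_gaussianReal (m₁ m₂ : ℝ) {v : ℝ≥0} (hv : v ≠ 0) :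
    llr (gaussianReal m₁ v) (gaussianReal m₂ v) =ᵐ[gaussianReal m₁ v]
      fun x => (m₁ - m₂) * (2 * x - m₁ - m₂) / (2 * v) := by
  have hdens := gaussianReal_eq_withDensity_exp m₁ m₂ hv
  have hrn := Measure.rnDeriv_withDensity (gaussianReal m₂ v) (f := fun x : ℝ =>
    ENNReal.ofReal (Real.exp ((m₁ - m₂) * (2 * x - m₁ - m₂) / (2 * v)))) (by fun_prop)
  rw [← hdens] at hrn
  refine (absolutelyContinuous_gaussianReal m₁ m₂ hv).ae_eq ?_
  filter_upwards [hrn] with x hx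
  rw [llr, hx, ENNReal.toReal_ofReal (Real.exp_pos _).le, Real.log_exp]

theorem toReal_klDiv_gaussianReal (m₁ m₂ : ℝ) {v : ℝ≥0} (hv : v ≠ 0) :
    (InformationTheory.klDiv (gaussianReal m₁ v) (gaussianReal m₂ v)).toReal =
      (m₁ - m₂) ^ 2 / (2 * v) := by
  have hint : Integrable (fun x : ℝ => x) (gaussianReal m₁ v) :=
    (memLp_id_gaussianReal 1).integrable (by simp)
  rw [InformationTheory.toReal_klDiv_of_measure_eq (absolutelyContinuous_gaussianReal m₁ m₂ hv)
    (by simp)]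
  calc ∫ x, llr (gaussianReal m₁ v) (gaussianReal m₂ v) x ∂gaussianReal m₁ v
      = ∫ x, ((m₁ - m₂) / v * x - (m₁ - m₂) * (m₁ + m₂) / (2 * v)) ∂gaussianReal m₁ v := by
        refine integral_congr_ae ((llr_gaussianReal m₁ m₂ hv).trans (.of_forall fun x => ?_))
        field_simp
        ring
    _ = (m₁ - m₂) / v * m₁ - (m₁ - m₂) * (m₁ + m₂) / (2 * v) := by
        rw [integral_sub (hint.const_mul _) (integrable_const _), integral_const_mul,
          integral_id_gaussianReal]
        simp
    _ = (m₁ - m₂) ^ 2 / (2 * v) := by field_simp; ring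

section WeightedLeastSquares

variable {ι : Type*} [Fintype ι]

theorem add_smul_dotProduct (p v f : ι → ℝ) (t : ℝ) :
    (p + t • v) ⬝ᵥ f = p ⬝ᵥ f + t * v ⬝ᵥ f := by
  rw [add_dotProduct, smul_dotProduct, smul_eq_mul]

theorem dotProduct_add_smul_sq (p y z : ι → ℝ) (t : ℝ) :
    p ⬝ᵥ (y + t • z) ^ 2 = p ⬝ᵥ y ^ 2 + 2 * t * p ⬝ᵥ (y * z) + t ^ 2 * p ⬝ᵥ z ^ 2 := by
  have hsq : (y + t • z) ^ 2 = y ^ 2 + (2 * t) • (y * z) + t ^ 2 • z ^ 2 := by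
    ext i
    simp only [Pi.pow_apply, Pi.add_apply, Pi.smul_apply, Pi.mul_apply, smul_eq_mul]
    ring
  rw [hsq, dotProduct_add, dotProduct_add, dotProduct_smul, dotProduct_smul, smul_eq_mul,
    smul_eq_mul]

theorem dotProduct_smul_sq (p y : ι → ℝ) (t : ℝ) : p ⬝ᵥ (t • y) ^ 2 = t ^ 2 * p ⬝ᵥ y ^ 2 := by
  rw [smul_pow, dotProduct_smul, smul_eq_mul]

theorem dotProduct_sq_nonneg {p : ι → ℝ} (hp : 0 ≤ p) (y : ι → ℝ) : 0 ≤ p ⬝ᵥ y ^ 2 :=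
  dotProduct_nonneg_of_nonneg hp fun i => sq_nonneg (y i)

theorem dotProduct_sq_eq_zero_iff {p : ι → ℝ} (hp : 0 ≤ p) {y : ι → ℝ} :
    p ⬝ᵥ y ^ 2 = 0 ↔ ∀ i, 0 < p i → y i = 0 := by
  simp only [dotProduct, Pi.pow_apply]
  rw [Finset.sum_eq_zero_iff_of_nonneg fun i _ => mul_nonneg (hp i) (sq_nonneg (y i))]
  refine forall_congr' fun i => ?_
  have hpos : 0 < p i ↔ p i ≠ 0 := (show 0 ≤ p i from hp i).lt_iff_ne'
  simp [hpos, or_iff_not_imp_left]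

theorem abs_dotProduct_mul_le (v a b : ι → ℝ) :
    |v ⬝ᵥ (a * b)| ≤ Fintype.card ι * (‖v‖ * (‖a‖ * ‖b‖)) := by
  rw [← nsmul_eq_mul, ← Finset.card_univ, ← Finset.sum_const]
  refine (Finset.abs_sum_le_sum_abs _ _).trans (Finset.sum_le_sum fun i _ => ?_)
  rw [Pi.mul_apply, abs_mul, abs_mul]
  gcongr
  exacts [norm_le_pi_norm v i, norm_le_pi_norm a i, norm_le_pi_norm b i]

theorem exists_mul_norm_sq_le_dotProduct_sq {p : ι → ℝ} (hp : 0 ≤ p)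
    {V : Submodule ℝ (ι → ℝ)} (hV : ∀ z ∈ V, p ⬝ᵥ z ^ 2 = 0 → z = 0) :
    ∃ c > 0, ∀ z ∈ V, c * ‖z‖ ^ 2 ≤ p ⬝ᵥ z ^ 2 := by
  have hcpt : IsCompact ((V : Set (ι → ℝ)) ∩ Metric.sphere 0 1) :=
    (isCompact_sphere _ _).inter_left V.closed_of_finiteDimensional
  have hpos : ∀ z ∈ (V : Set (ι → ℝ)) ∩ Metric.sphere 0 1, 0 < p ⬝ᵥ z ^ 2 := fun z hz =>
    (dotProduct_sq_nonneg hp z).lt_of_ne' fun h0 =>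
      ne_zero_of_mem_unit_sphere ⟨z, hz.2⟩ (hV z hz.1 h0)
  obtain ⟨c, hc, hmin⟩ := hcpt.exists_forall_le' (by fun_prop) hpos
  refine ⟨c, hc, fun z hz => ?_⟩
  rcases eq_or_ne z 0 with rfl | hz0
  · simp
  have hle := hmin (‖z‖⁻¹ • z) ⟨V.smul_mem _ hz, by simpa using norm_smul_inv_norm (𝕜 := ℝ) hz0⟩
  have hn : 0 < ‖z‖ := norm_pos_iff.2 hz0
  rwa [dotProduct_smul_sq, inv_pow, inv_mul_eq_div, le_div_iff₀ (by positivity)] at hle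

/-- `y` minimizes the quadratic energy `∑ i, p i * y i ^ 2` over the affine subspace `A`, that is,
it solves a least squares problem with weights `p`. -/
def IsEnergyMinimizer (A : AffineSubspace ℝ (ι → ℝ)) (p y : ι → ℝ) : Prop :=
  y ∈ A ∧ ∀ z ∈ A, p ⬝ᵥ y ^ 2 ≤ p ⬝ᵥ z ^ 2

/-- The least energy of a point of `A` with weights `p`. It is meaningful for nonnegative weights
only, where the infimum is not taken over an unbounded set. -/
noncomputable def minEnergy (A : AffineSubspace ℝ (ι → ℝ)) (p : ι → ℝ) : ℝ :=
  ⨅ y : A, p ⬝ᵥ (y : ι → ℝ) ^ 2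

variable {A : AffineSubspace ℝ (ι → ℝ)} {p q y y' : ι → ℝ}

namespace IsEnergyMinimizer

theorem minEnergy_eq (hy : IsEnergyMinimizer A p y) : minEnergy A p = p ⬝ᵥ y ^ 2 :=
  IsLeast.csInf_eq ⟨⟨⟨y, hy.1⟩, rfl⟩, forall_mem_range.2 fun z => hy.2 z z.2⟩

theorem smul {c : ℝ} (hc : 0 ≤ c) (hy : IsEnergyMinimizer A p y) :
    IsEnergyMinimizer A (c • p) y :=
  ⟨hy.1, fun z hz => by
    rw [smul_dotProduct, smul_dotProduct]
    exact smul_le_smul_of_nonneg_left (hy.2 z hz) hc⟩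

theorem dotProduct_mul_eq_zero (hy : IsEnergyMinimizer A p y) {v : ι → ℝ}
    (hv : v ∈ A.direction) : p ⬝ᵥ (y * v) = 0 := by
  have hquad : ∀ t : ℝ, 0 ≤ p ⬝ᵥ v ^ 2 * (t * t) + 2 * p ⬝ᵥ (y * v) * t + 0 := fun t => by
    have hmem : y + t • v ∈ A := by
      rw [add_comm]
      exact AffineSubspace.vadd_mem_of_mem_direction (A.direction.smul_mem t hv) hy.1
    have hle := hy.2 _ hmem
    rw [dotProduct_add_smul_sq] at hle
    linarith
  have hdiscrim := discrim_le_zero hquad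
  rw [discrim] at hdiscrim
  nlinarith

theorem dotProduct_sub_sq (hy : IsEnergyMinimizer A p y) (hy' : IsEnergyMinimizer A q y') :
    p ⬝ᵥ (y' - y) ^ 2 = (p - q) ⬝ᵥ (y' * (y' - y)) := by
  have hdir : y' - y ∈ A.direction := AffineSubspace.vsub_mem_direction hy'.1 hy.1
  rw [sub_dotProduct, hy'.dotProduct_mul_eq_zero hdir, sub_zero, sq, sub_mul, dotProduct_sub,
    hy.dotProduct_mul_eq_zero hdir, sub_zero]

theorem mul_norm_sub_le (hy : IsEnergyMinimizer A p y) (hy' : IsEnergyMinimizer A q y') {c : ℝ}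
    (hc : ∀ z ∈ A.direction, c * ‖z‖ ^ 2 ≤ p ⬝ᵥ z ^ 2) :
    c * ‖y' - y‖ ≤ Fintype.card ι * ‖y'‖ * ‖q - p‖ := by
  have hle : c * ‖y' - y‖ ^ 2 ≤ Fintype.card ι * ‖y'‖ * ‖q - p‖ * ‖y' - y‖ :=
    calc c * ‖y' - y‖ ^ 2
        ≤ p ⬝ᵥ (y' - y) ^ 2 := hc _ (AffineSubspace.vsub_mem_direction hy'.1 hy.1)
      _ = (p - q) ⬝ᵥ (y' * (y' - y)) := hy.dotProduct_sub_sq hy'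
      _ ≤ Fintype.card ι * (‖p - q‖ * (‖y'‖ * ‖y' - y‖)) :=
        (le_abs_self _).trans (abs_dotProduct_mul_le _ _ _)
      _ = Fintype.card ι * ‖y'‖ * ‖q - p‖ * ‖y' - y‖ := by rw [norm_sub_rev p q]; ring
  rcases (norm_nonneg (y' - y)).eq_or_lt with h0 | h0
  · rw [← h0, mul_zero]
    positivity
  · exact le_of_mul_le_mul_right (by linarith) h0

theorem eq_of_coercive (hy : IsEnergyMinimizer A p y) (hy' : IsEnergyMinimizer A p y')
    (hp : ∀ z ∈ A.direction, p ⬝ᵥ z ^ 2 = 0 → z = 0) : y' = y := by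
  refine sub_eq_zero.1 (hp _ (AffineSubspace.vsub_mem_direction hy'.1 hy.1) ?_)
  rw [hy.dotProduct_sub_sq hy', sub_self, zero_dotProduct]

end IsEnergyMinimizer

theorem exists_isEnergyMinimizer_of_pos (hA : (A : Set (ι → ℝ)).Nonempty) (hp : ∀ i, 0 < p i) :
    ∃ y, IsEnergyMinimizer A p y := by
  obtain ⟨y₀, hy₀⟩ := hA
  obtain ⟨c, hc, hcoer⟩ := exists_mul_norm_sq_le_dotProduct_sq (p := p) (V := ⊤)
    (fun i => (hp i).le) fun z _ hz =>
      funext fun i => (dotProduct_sq_eq_zero_iff fun i => (hp i).le).1 hz i (hp i)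
  have htop : Tendsto (fun y : ι → ℝ => p ⬝ᵥ y ^ 2) (cocompact (ι → ℝ)) atTop :=
    tendsto_atTop_mono (fun y => hcoer y trivial) <|
      ((tendsto_pow_atTop two_ne_zero).comp tendsto_norm_cocompact_atTop).const_mul_atTop hc
  obtain ⟨y, hy, hmin⟩ := ContinuousOn.exists_isMinOn' (f := fun y : ι → ℝ => p ⬝ᵥ y ^ 2)
    (by fun_prop) A.closed_of_finiteDimensional hy₀
    ((htop.eventually_ge_atTop _).filter_mono inf_le_left)
  exact ⟨y, hy, fun z hz => hmin hz⟩

theorem mem_of_tendsto_smul_mem_direction {E : Type*} [NormedAddCommGroup E] [NormedSpace ℝ E]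
    [FiniteDimensional ℝ E] {A : AffineSubspace ℝ E} {r : ℕ → ℝ} {y : ℕ → E} {z : E}
    (hy : ∀ n, y n ∈ A) (hr : Tendsto r atTop (𝓝 0))
    (hz : Tendsto (fun n => r n • y n) atTop (𝓝 z)) : z ∈ A.direction := by
  have hlim : Tendsto (fun n => r n • (y n - y 0)) atTop (𝓝 z) := by
    simpa [smul_sub] using hz.sub (hr.smul_const (y 0))
  exact A.direction.closed_of_finiteDimensional.mem_of_tendsto hlim <| .of_forall fun n =>
    A.direction.smul_mem _ (AffineSubspace.vsub_mem_direction (hy n) (hy 0))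

theorem eventually_forall_mul_pos {κ : Type*} [Finite κ] {r : ℕ → ℝ} {y : ℕ → κ → ℝ} {z : κ → ℝ}
    (hr : ∀ n, 0 ≤ r n)
    (hz : Tendsto (fun n => r n • y n) atTop (𝓝 z)) :
    ∀ᶠ n in atTop, ∀ i, z i ≠ 0 → 0 < y n i * z i := by
  refine eventually_all.2 fun i => ?_
  by_cases hzi : z i = 0
  · exact .of_forall fun n h => absurd hzi h
  · have hlim : Tendsto (fun n => r n * (y n i * z i)) atTop (𝓝 (z i * z i)) := by
      simpa [mul_assoc] using (tendsto_pi_nhds.1 hz i).mul_const (z i)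
    filter_upwards [hlim.eventually_const_lt (mul_self_pos.2 hzi)] with n hn _
    exact pos_of_mul_pos_right hn (hr n)

/- If minimizers `y n` were unbounded, a limit `z` of their directions would lie in the direction of
`A` and have the same sign pattern as `y n`, against the orthogonality of `y n` and `z`. -/
theorem exists_norm_le_of_isEnergyMinimizer (A : AffineSubspace ℝ (ι → ℝ)) :
    ∃ R : ℝ, ∀ p y : ι → ℝ, (∀ i, 0 < p i) → IsEnergyMinimizer A p y → ‖y‖ ≤ R := by
  by_contra! hcon
  choose p y hp hy hyn using fun n : ℕ => hcon (n + 1)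
  have hpos : ∀ n, 0 < ‖y n‖ := fun n => lt_trans (by positivity) (hyn n)
  obtain ⟨z, hz, φ, hφ, hlim⟩ := (isCompact_sphere (0 : ι → ℝ) 1).tendsto_subseq
    (x := fun n => ‖y n‖⁻¹ • y n) fun n => by
      simpa using norm_smul_inv_norm (𝕜 := ℝ) (norm_pos_iff.1 (hpos n))
  have hnorm : Tendsto (fun n => ‖y n‖) atTop atTop :=
    tendsto_atTop_mono (fun n => (hyn n).le)
      (tendsto_atTop_add_const_right _ _ tendsto_natCast_atTop_atTop)
  have hdir : z ∈ A.direction := mem_of_tendsto_smul_mem_direction (fun n => (hy (φ n)).1)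
    (tendsto_inv_atTop_zero.comp (hnorm.comp hφ.tendsto_atTop)) hlim
  obtain ⟨n, hn⟩ := (eventually_forall_mul_pos (y := y ∘ φ)
    (fun n => inv_nonneg.2 (norm_nonneg (y (φ n)))) hlim).exists
  obtain ⟨i, hi⟩ := Function.ne_iff.1 (ne_zero_of_mem_unit_sphere ⟨z, hz⟩)
  refine ((hy (φ n)).dotProduct_mul_eq_zero hdir).not_gt
    (Finset.sum_pos' (fun j _ => ?_) ⟨i, Finset.mem_univ i, mul_pos (hp _ i) (hn i hi)⟩)
  rcases eq_or_ne (z j) 0 with hj | hj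
  · simp [hj]
  · exact (mul_pos (hp _ j) (hn j hj)).le

/-- `y` is a limit of energy minimizers at positive weights converging to `p`. Where the weights
`p` do not determine the minimizer, this singles out the minimizers that matter for generalized
gradients. -/
def IsRegularMinimizer (A : AffineSubspace ℝ (ι → ℝ)) (p y : ι → ℝ) : Prop :=
  (p, y) ∈ closure {w : (ι → ℝ) × (ι → ℝ) | (∀ i, 0 < w.1 i) ∧ IsEnergyMinimizer A w.1 w.2}

theorem IsEnergyMinimizer.isRegularMinimizer (hy : IsEnergyMinimizer A p y) (hp : ∀ i, 0 < p i) :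
    IsRegularMinimizer A p y :=
  subset_closure ⟨hp, hy⟩

theorem isClosed_setOf_isEnergyMinimizer (A : AffineSubspace ℝ (ι → ℝ)) :
    IsClosed {w : (ι → ℝ) × (ι → ℝ) | IsEnergyMinimizer A w.1 w.2} := by
  simp only [IsEnergyMinimizer, ofPred_and, ofPred_forall]
  exact (A.closed_of_finiteDimensional.preimage continuous_snd).inter <|
    isClosed_iInter fun z => isClosed_iInter fun _ => isClosed_le (by fun_prop) (by fun_prop)

theorem exists_norm_le_of_isRegularMinimizer (A : AffineSubspace ℝ (ι → ℝ)) :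
    ∃ R : ℝ, ∀ p y : ι → ℝ, IsRegularMinimizer A p y → ‖y‖ ≤ R := by
  obtain ⟨R, hR⟩ := exists_norm_le_of_isEnergyMinimizer A
  refine ⟨R, fun p y hy => ?_⟩
  exact closure_minimal (t := {w : (ι → ℝ) × (ι → ℝ) | ‖w.2‖ ≤ R})
    (fun w hw => hR _ _ hw.1 hw.2) (isClosed_le (by fun_prop) (by fun_prop)) hy

theorem exists_subseq_tendsto_isRegularMinimizer {κ : Type*} [Finite κ]
    {A : κ → AffineSubspace ℝ (ι → ℝ)} {p : ℕ → ι → ℝ} {y : ℕ → κ → ι → ℝ} {p₀ : ι → ℝ}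
    (hp : Tendsto p atTop (𝓝 p₀)) (hy : ∀ n x, IsRegularMinimizer (A x) (p n) (y n x)) :
    ∃ y₀ : κ → ι → ℝ, (∀ x, IsRegularMinimizer (A x) p₀ (y₀ x)) ∧
      ∃ φ : ℕ → ℕ, StrictMono φ ∧ Tendsto (y ∘ φ) atTop (𝓝 y₀) := by
  choose R hR using fun x => exists_norm_le_of_isRegularMinimizer (A x)
  obtain ⟨y₀, -, φ, hφ, hlim⟩ :=
    (isCompact_univ_pi fun x => isCompact_closedBall (0 : ι → ℝ) (R x)).tendsto_subseq
      (x := y) fun n x _ => mem_closedBall_zero_iff.2 (hR x _ _ (hy n x))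
  refine ⟨y₀, fun x => ?_, φ, hφ, hlim⟩
  exact isClosed_closure.mem_of_tendsto
    ((hp.comp hφ.tendsto_atTop).prodMk_nhds (tendsto_pi_nhds.1 hlim x))
    (.of_forall fun n => hy (φ n) x)

theorem exists_isRegularMinimizer (hA : (A : Set (ι → ℝ)).Nonempty) (hp : 0 ≤ p) :
    ∃ y, IsRegularMinimizer A p y := by
  have hpos : ∀ (n : ℕ) i, 0 < p i + 1 / ((n : ℝ) + 1) := fun n i =>
    add_pos_of_nonneg_of_pos (hp i) (by positivity)
  choose y hy using fun n => exists_isEnergyMinimizer_of_pos hA (hpos n)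
  have hlim : Tendsto (fun (n : ℕ) i => p i + 1 / ((n : ℝ) + 1)) atTop (𝓝 p) :=
    tendsto_pi_nhds.2 fun i => by
      simpa using tendsto_one_div_add_atTop_nhds_zero_nat.const_add (p i)
  obtain ⟨y₀, hy₀, -⟩ := exists_subseq_tendsto_isRegularMinimizer (κ := Unit) (A := fun _ => A)
    hlim (fun n _ => (hy n).isRegularMinimizer (hpos n))
  exact ⟨y₀ (), hy₀ ()⟩

theorem IsRegularMinimizer.isEnergyMinimizer (hy : IsRegularMinimizer A p y) :
    IsEnergyMinimizer A p y :=
  closure_minimal (fun _ hw => hw.2) (isClosed_setOf_isEnergyMinimizer A) hy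

theorem minEnergy_le (hp : 0 ≤ p) (hy : y ∈ A) : minEnergy A p ≤ p ⬝ᵥ y ^ 2 :=
  ciInf_le (f := fun y : A => p ⬝ᵥ (y : ι → ℝ) ^ 2)
    ⟨0, forall_mem_range.2 fun z => dotProduct_sq_nonneg hp z⟩ ⟨y, hy⟩

theorem minEnergy_nonneg (A : AffineSubspace ℝ (ι → ℝ)) (hp : 0 ≤ p) : 0 ≤ minEnergy A p :=
  Real.iInf_nonneg fun y => dotProduct_sq_nonneg hp y

theorem minEnergy_eq_zero_iff (hA : (A : Set (ι → ℝ)).Nonempty) (hp : 0 ≤ p) :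
    minEnergy A p = 0 ↔ ∃ y ∈ A, ∀ i, 0 < p i → y i = 0 := by
  constructor
  · intro h0
    obtain ⟨y, hy⟩ := exists_isRegularMinimizer hA hp
    rw [hy.isEnergyMinimizer.minEnergy_eq, dotProduct_sq_eq_zero_iff hp] at h0
    exact ⟨y, hy.isEnergyMinimizer.1, h0⟩
  · rintro ⟨y, hy, h0⟩
    exact le_antisymm ((minEnergy_le hp hy).trans_eq ((dotProduct_sq_eq_zero_iff hp).2 h0))
      (minEnergy_nonneg A hp)

end WeightedLeastSquares

section Danskin

variable {ι κ : Type*}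

theorem eq_zero_of_nonpos_of_map_one_nonneg [Finite ι] {L : (ι → ℝ) →L[ℝ] ℝ}
    (hL : ∀ q, 0 ≤ q → L q ≤ 0) (h1 : 0 ≤ L 1) : L = 0 := by
  classical
  cases nonempty_fintype ι
  have hsingle : ∀ i ∈ Finset.univ, L (Pi.single i 1) ≤ 0 := fun i _ =>
    hL _ (Pi.single_nonneg.2 zero_le_one)
  have hsum : ∑ i, L (Pi.single i 1) = L 1 := by
    rw [← map_sum]
    exact congrArg L (Finset.univ_sum_single (1 : ι → ℝ))
  have hzero := (Finset.sum_eq_zero_iff_of_nonpos hsingle).1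
    ((Finset.sum_nonpos hsingle).antisymm (hsum ▸ h1))
  refine ContinuousLinearMap.coe_injective ((Pi.basisFun ℝ ι).ext fun i => ?_)
  simpa using hzero i (Finset.mem_univ i)

/-- The gradient in `p` that Danskin's formula attaches to `mixedEnergy A μ` when `y x` is the
minimizer over `A x`. -/
def mixedGradient [Fintype κ] (μ : κ → ℝ) (y : κ → ι → ℝ) : ι → ℝ :=
  ∑ x, μ x • y x ^ 2

theorem continuous_mixedGradient [Fintype κ] :
    Continuous fun w : (κ → ℝ) × (κ → ι → ℝ) => mixedGradient w.1 w.2 := by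
  unfold mixedGradient
  fun_prop

theorem mixedGradient_sub [Fintype κ] (μ ν : κ → ℝ) (y : κ → ι → ℝ) :
    mixedGradient (μ - ν) y = mixedGradient μ y - mixedGradient ν y := by
  simp only [mixedGradient, Pi.sub_apply, sub_smul, Finset.sum_sub_distrib]

theorem hasDerivAt_mixedGradient [Finite ι] [Fintype κ] {μ : ℝ → κ → ℝ} {μ' : κ → ℝ}
    {y : ℝ → κ → ι → ℝ} {w' : κ → ι → ℝ} {t : ℝ} (hμ' : HasDerivAt μ μ' t)
    (hw' : ∀ x, HasDerivAt (fun s => y s x ^ 2) (w' x) t) :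
    HasDerivAt (fun s => mixedGradient (μ s) (y s))
      (mixedGradient μ' (y t) + ∑ x, μ t x • w' x) t := by
  cases nonempty_fintype ι
  rw [mixedGradient, add_comm, ← Finset.sum_add_distrib]
  exact .fun_sum fun x _ => (hasDerivAt_pi.1 hμ' x).fun_smul (hw' x)

variable [Fintype ι] [Fintype κ]

/-- The linear functional with coefficients `f`: gradients of functions of the weights are turned
into Fréchet derivatives by it. -/
noncomputable def dotCLM (f : ι → ℝ) : (ι → ℝ) →L[ℝ] ℝ :=
  (dotProductBilin ℝ ℝ f).toContinuousLinearMap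

theorem dotCLM_apply (f q : ι → ℝ) : dotCLM f q = q ⬝ᵥ f :=
  dotProduct_comm f q

variable {A : AffineSubspace ℝ (ι → ℝ)} {p q y z : ι → ℝ}

theorem IsEnergyMinimizer.dotProduct_sq_eq (hy : IsEnergyMinimizer A p y) (hz : z ∈ A) :
    p ⬝ᵥ z ^ 2 = p ⬝ᵥ y ^ 2 + p ⬝ᵥ (z - y) ^ 2 := by
  have h := dotProduct_add_smul_sq p y (z - y) 1
  rwa [one_smul, add_sub_cancel,
    hy.dotProduct_mul_eq_zero (v := z - y) (AffineSubspace.vsub_mem_direction hz hy.1), mul_zero,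
    add_zero, one_pow, one_mul] at h

theorem hasFDerivWithinAt_minEnergy (hp : 0 ≤ p)
    (hcoer : ∀ z ∈ A.direction, p ⬝ᵥ z ^ 2 = 0 → z = 0) (hy : IsEnergyMinimizer A p y) :
    HasFDerivWithinAt (minEnergy A) (dotCLM (y ^ 2)) (Ici 0) p := by
  obtain ⟨c, hc, hle⟩ := exists_mul_norm_sq_le_dotProduct_sq hp hcoer
  obtain ⟨R, hR⟩ := exists_norm_le_of_isRegularMinimizer A
  have hO : (fun q => minEnergy A q - dotCLM (y ^ 2) q) =O[𝓝[Ici 0] p] fun q => ‖q - p‖ ^ 2 := by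
    refine Asymptotics.IsBigO.of_bound (Fintype.card ι * ‖y‖ * (Fintype.card ι * R / c)) ?_
    filter_upwards [self_mem_nhdsWithin] with q hq
    obtain ⟨y', hy'⟩ := exists_isRegularMinimizer ⟨y, hy.1⟩ hq
    have hclose : ‖y - y'‖ ≤ Fintype.card ι * R / c * ‖q - p‖ := by
      rw [norm_sub_rev, div_mul_eq_mul_div, le_div_iff₀' hc]
      refine (hy.mul_norm_sub_le hy'.isEnergyMinimizer hle).trans ?_
      gcongr
      exact hR _ _ hy'
    have hdiff : minEnergy A q - dotCLM (y ^ 2) q = -((q - p) ⬝ᵥ (y * (y - y'))) := by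
      rw [dotCLM_apply, hy'.isEnergyMinimizer.minEnergy_eq,
        hy'.isEnergyMinimizer.dotProduct_sq_eq hy.1, hy'.isEnergyMinimizer.dotProduct_sub_sq hy]
      ring
    rw [hdiff, norm_neg, Real.norm_eq_abs, Real.norm_of_nonneg (by positivity)]
    calc |(q - p) ⬝ᵥ (y * (y - y'))|
        ≤ Fintype.card ι * (‖q - p‖ * (‖y‖ * ‖y - y'‖)) := abs_dotProduct_mul_le _ _ _
      _ ≤ Fintype.card ι * (‖q - p‖ * (‖y‖ * (Fintype.card ι * R / c * ‖q - p‖))) := by gcongr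
      _ = Fintype.card ι * ‖y‖ * (Fintype.card ι * R / c) * ‖q - p‖ ^ 2 := by ring
  have h := (hO.hasFDerivWithinAt hp one_lt_two).add (dotCLM (y ^ 2)).hasFDerivWithinAt
  rw [zero_add] at h
  exact h.congr (fun q _ => by simp) (by simp)

theorem concaveOn_minEnergy (hA : (A : Set (ι → ℝ)).Nonempty) :
    ConcaveOn ℝ (Ici 0) (minEnergy A) := by
  have : Nonempty A := hA.to_subtype
  refine ⟨convex_Ici 0, fun p hp q hq a b ha hb _ => le_ciInf fun y => ?_⟩
  rw [add_dotProduct, smul_dotProduct, smul_dotProduct]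
  exact add_le_add (smul_le_smul_of_nonneg_left (minEnergy_le hp y.2) ha)
    (smul_le_smul_of_nonneg_left (minEnergy_le hq y.2) hb)

theorem exists_lipschitzOnWith_minEnergy (hA : (A : Set (ι → ℝ)).Nonempty) :
    ∃ C, LipschitzOnWith C (minEnergy A) (Ici 0) := by
  obtain ⟨R, hR⟩ := exists_norm_le_of_isRegularMinimizer A
  refine ⟨(Fintype.card ι * (R * R)).toNNReal, .of_le_add_mul' _ fun p hp q hq => ?_⟩
  obtain ⟨y, hy⟩ := exists_isRegularMinimizer hA hq
  have hyR := hR _ _ hy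
  have hR0 : 0 ≤ R := (norm_nonneg y).trans hyR
  calc minEnergy A p
      ≤ p ⬝ᵥ y ^ 2 := minEnergy_le hp hy.isEnergyMinimizer.1
    _ = minEnergy A q + (p - q) ⬝ᵥ (y * y) := by
      rw [hy.isEnergyMinimizer.minEnergy_eq, sub_dotProduct, ← sq]
      ring
    _ ≤ minEnergy A q + Fintype.card ι * (‖p - q‖ * (‖y‖ * ‖y‖)) := by
      gcongr
      exact (le_abs_self _).trans (abs_dotProduct_mul_le _ _ _)
    _ ≤ minEnergy A q + Fintype.card ι * (‖p - q‖ * (R * R)) := by gcongr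
    _ = minEnergy A q + Fintype.card ι * (R * R) * dist p q := by
      rw [dist_eq_norm]
      ring

theorem IsRegularMinimizer.apply_sq_le {i : ι} {M : ℝ}
    (hM : ∀ p ∈ stdSimplex ℝ ι, (∀ j, 0 < p j) → ∀ y, IsEnergyMinimizer A p y → y i ^ 2 ≤ M)
    (hy : IsRegularMinimizer A p y) : y i ^ 2 ≤ M := by
  refine closure_minimal (t := {w : (ι → ℝ) × (ι → ℝ) | w.2 i ^ 2 ≤ M}) (fun w hw => ?_)
    (isClosed_le (by fun_prop) continuous_const) hy
  have hsum : 0 < ∑ j, w.1 j := Finset.sum_pos (fun j _ => hw.1 j) ⟨i, Finset.mem_univ i⟩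
  have hpos : ∀ j, 0 < ((∑ j, w.1 j)⁻¹ • w.1) j := fun j => mul_pos (inv_pos.2 hsum) (hw.1 j)
  refine hM _ ⟨fun j => (hpos j).le, ?_⟩ hpos _ (hw.2.smul (inv_nonneg.2 hsum.le))
  simp only [Pi.smul_apply, smul_eq_mul]
  rw [← Finset.mul_sum, inv_mul_cancel₀ hsum.ne']

/-- The payoff of the game in which one player chooses the weights `p` and the other a mixture `μ`
of the least squares problems over the subspaces `A x`. -/
noncomputable def mixedEnergy (A : κ → AffineSubspace ℝ (ι → ℝ)) (μ : κ → ℝ) (p : ι → ℝ) : ℝ :=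
  ∑ x, μ x * minEnergy (A x) p

theorem dotProduct_mixedGradient (p : ι → ℝ) (μ : κ → ℝ) (y : κ → ι → ℝ) :
    p ⬝ᵥ mixedGradient μ y = ∑ x, μ x * p ⬝ᵥ y x ^ 2 := by
  simp only [mixedGradient, dotProduct_sum, dotProduct_smul, smul_eq_mul]

variable {A : κ → AffineSubspace ℝ (ι → ℝ)} {μ : κ → ℝ} {y : κ → ι → ℝ}

theorem mixedEnergy_eq (hy : ∀ x, IsEnergyMinimizer (A x) p (y x)) :
    mixedEnergy A μ p = p ⬝ᵥ mixedGradient μ y := by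
  rw [dotProduct_mixedGradient]
  exact Finset.sum_congr rfl fun x _ => by rw [(hy x).minEnergy_eq]

theorem mixedEnergy_le (hp : 0 ≤ p) (hμ : 0 ≤ μ) (hy : ∀ x, y x ∈ A x) :
    mixedEnergy A μ p ≤ p ⬝ᵥ mixedGradient μ y := by
  rw [dotProduct_mixedGradient]
  exact Finset.sum_le_sum fun x _ => mul_le_mul_of_nonneg_left (minEnergy_le hp (hy x)) (hμ x)

theorem apply_le_dotProduct_mixedGradient {f : (ι → ℝ) →L[ℝ] ℝ} (hp : 0 ≤ p) (hμ : 0 ≤ μ)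
    (hf : HasFDerivWithinAt (mixedEnergy A μ) f (Ici 0) p)
    (hy : ∀ x, IsEnergyMinimizer (A x) p (y x)) (hq : 0 ≤ q) : f q ≤ q ⬝ᵥ mixedGradient μ y := by
  have hmax : IsMaxOn (fun q => mixedEnergy A μ q - dotCLM (mixedGradient μ y) q) (Ici 0) p :=
    fun q hq => by
      simp only [dotCLM_apply, mem_ofPred_eq]
      rw [mixedEnergy_eq hy, sub_self]
      exact sub_nonpos.2 (mixedEnergy_le hq hμ fun x => (hy x).1)
  have hnonpos := hmax.localize.hasFDerivWithinAt_nonpos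
    (hf.sub (dotCLM (mixedGradient μ y)).hasFDerivWithinAt) <|
    mem_posTangentConeAt_of_segment_subset <|
      (convex_Ici (0 : ι → ℝ)).segment_subset hp (add_nonneg hp hq)
  rwa [sub_apply, dotCLM_apply, sub_nonpos] at hnonpos

theorem dotProduct_mixedGradient_le_slope (hp : 0 ≤ p) (hμ : 0 ≤ μ) {s : ℝ} (hs : 0 < s)
    (hy : ∀ x, IsEnergyMinimizer (A x) (p + s • q) (y x)) :
    q ⬝ᵥ mixedGradient μ y ≤ s⁻¹ • (mixedEnergy A μ (p + s • q) - mixedEnergy A μ p) := by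
  rw [smul_eq_mul, ← div_eq_inv_mul, le_div_iff₀' hs, mixedEnergy_eq hy, add_smul_dotProduct]
  linarith [mixedEnergy_le hp hμ fun x => (hy x).1]

/- Minimizers at `p` are supergradients and bound every directional derivative from above. Those at
`p + s • 1` bound the derivative along `1` from below as `s ↓ 0`, and this forces equality. -/
theorem exists_isRegularMinimizer_eq_mixedGradient {f : (ι → ℝ) →L[ℝ] ℝ}
    (hA : ∀ x, (A x : Set (ι → ℝ)).Nonempty) (hp : 0 ≤ p) (hμ : 0 ≤ μ)
    (hf : HasFDerivWithinAt (mixedEnergy A μ) f (Ici 0) p) :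
    ∃ y, (∀ x, IsRegularMinimizer (A x) p (y x)) ∧ f = dotCLM (mixedGradient μ y) := by
  obtain ⟨s, -, hs, hslim⟩ := exists_seq_strictAnti_tendsto (0 : ℝ)
  have hq : ∀ n, 0 ≤ p + s n • (1 : ι → ℝ) := fun n =>
    add_nonneg hp (smul_nonneg (hs n).le zero_le_one)
  have hsmul : Tendsto (fun n => s n • (1 : ι → ℝ)) atTop (𝓝 0) := by
    simpa using hslim.smul_const (1 : ι → ℝ)
  choose y hy using fun n x => exists_isRegularMinimizer (hA x) (hq n)
  obtain ⟨y₀, hy₀, φ, hφ, hlim⟩ := exists_subseq_tendsto_isRegularMinimizer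
    (by simpa using hsmul.const_add p) hy
  refine ⟨y₀, hy₀, sub_eq_zero.1 (eq_zero_of_nonpos_of_map_one_nonneg (fun q hq0 => ?_) ?_)⟩
  · rw [sub_apply, dotCLM_apply, sub_nonpos]
    exact apply_le_dotProduct_mixedGradient hp hμ hf (fun x => (hy₀ x).isEnergyMinimizer) hq0
  · rw [sub_apply, dotCLM_apply, sub_nonneg]
    have hslope := hf.lim (c := fun n => (s n)⁻¹) hsmul (.of_forall hq)
      (tendsto_const_nhds.congr fun n => (inv_smul_smul₀ (hs n).ne' _).symm)
    have hgrad := ((dotCLM 1).continuous.comp continuous_mixedGradient).tendsto (μ, y₀) |>.comp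
      (tendsto_const_nhds.prodMk_nhds hlim)
    exact le_of_tendsto_of_tendsto' hgrad (hslope.comp hφ.tendsto_atTop) fun n =>
      dotProduct_mixedGradient_le_slope hp hμ (hs _) fun x => (hy (φ n) x).isEnergyMinimizer

end Danskin

section Simplex

variable {ι : Type*} [Fintype ι] {q f : ι → ℝ}

theorem dotProduct_le_ciSup (hq : q ∈ stdSimplex ℝ ι) (f : ι → ℝ) : q ⬝ᵥ f ≤ ⨆ i, f i :=
  calc q ⬝ᵥ f ≤ q ⬝ᵥ fun _ => ⨆ i, f i :=
        dotProduct_le_dotProduct_of_nonneg_left (le_ciSup (finite_range f).bddAbove) hq.1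
    _ = ⨆ i, f i := by simp [dotProduct, ← Finset.sum_mul, hq.2]

theorem ciInf_le_dotProduct (hq : q ∈ stdSimplex ℝ ι) (f : ι → ℝ) : ⨅ i, f i ≤ q ⬝ᵥ f :=
  calc ⨅ i, f i = q ⬝ᵥ fun _ => ⨅ i, f i := by simp [dotProduct, ← Finset.sum_mul, hq.2]
    _ ≤ q ⬝ᵥ f :=
        dotProduct_le_dotProduct_of_nonneg_left (ciInf_le (finite_range f).bddBelow) hq.1

theorem dotProduct_eq_ciSup [Nonempty ι] (hq : q ∈ stdSimplex ℝ ι)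
    (hmax : IsMaxOn (· ⬝ᵥ f) (stdSimplex ℝ ι) q) : q ⬝ᵥ f = ⨆ i, f i := by
  classical
  refine (dotProduct_le_ciSup hq f).antisymm (ciSup_le fun i => ?_)
  simpa using hmax (single_mem_stdSimplex ℝ i)

theorem dotProduct_eq_ciInf [Nonempty ι] (hq : q ∈ stdSimplex ℝ ι)
    (hmin : IsMinOn (· ⬝ᵥ f) (stdSimplex ℝ ι) q) : q ⬝ᵥ f = ⨅ i, f i := by
  classical
  refine (le_ciInf fun i => ?_).antisymm (ciInf_le_dotProduct hq f)
  simpa using hmin (single_mem_stdSimplex ℝ i)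

theorem eq_zero_of_isMaxOn_dotProduct (hq : q ∈ stdSimplex ℝ ι)
    (hmax : IsMaxOn (· ⬝ᵥ f) (stdSimplex ℝ ι) q) {i j : ι} (hij : f i < f j) : q i = 0 := by
  have : Nonempty ι := ⟨i⟩
  have hle : ∀ k, f k ≤ ⨆ l, f l := le_ciSup (finite_range f).bddAbove
  have hsum : ∑ k, q k * ((⨆ l, f l) - f k) = 0 := by
    rw [← dotProduct_eq_ciSup hq hmax]
    simp only [mul_sub, Finset.sum_sub_distrib, ← Finset.sum_mul, hq.2, one_mul]
    exact sub_self _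
  have hzero := (Finset.sum_eq_zero_iff_of_nonneg fun k _ =>
    mul_nonneg (hq.1 k) (sub_nonneg.2 (hle k))).1 hsum i (Finset.mem_univ i)
  exact (mul_eq_zero.1 hzero).resolve_right (sub_pos.2 (hij.trans_le (hle j))).ne'

theorem exists_pos_of_mem_stdSimplex (hq : q ∈ stdSimplex ℝ ι) : ∃ i, 0 < q i := by
  obtain ⟨i, -, hi⟩ := Finset.exists_lt_of_sum_lt (s := Finset.univ) (f := fun _ => 0) (g := q)
    (by simp [hq.2])
  exact ⟨i, hi⟩

theorem exists_forall_pos_mem_stdSimplex (ι : Type*) [Fintype ι] [Nonempty ι] :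
    ∃ q ∈ stdSimplex ℝ ι, ∀ i, 0 < q i :=
  ⟨fun _ => (Fintype.card ι : ℝ)⁻¹, ⟨fun _ => by positivity, by simp⟩, fun _ => by positivity⟩

theorem abs_ciSup_sub_ciSup_le_dist [Nonempty ι] (f g : ι → ℝ) :
    |(⨆ i, f i) - ⨆ i, g i| ≤ dist f g := by
  have key : ∀ f g : ι → ℝ, ⨆ i, f i ≤ (⨆ i, g i) + dist f g := fun f g => ciSup_le fun i => by
    have hi := le_ciSup (finite_range g).bddAbove i
    have hdist := (le_abs_self (f i - g i)).trans (dist_le_pi_dist f g i)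
    linarith
  exact abs_sub_le_iff.2
    ⟨sub_le_iff_le_add'.2 (key f g), sub_le_iff_le_add'.2 (dist_comm f g ▸ key g f)⟩

theorem abs_ciInf_sub_ciInf_le_dist [Nonempty ι] (f g : ι → ℝ) :
    |(⨅ i, f i) - ⨅ i, g i| ≤ dist f g := by
  have key : ∀ f g : ι → ℝ, (⨅ i, f i) - dist f g ≤ ⨅ i, g i := fun f g => le_ciInf fun i => by
    have hi := ciInf_le (finite_range f).bddBelow i
    have hdist := (le_abs_self (f i - g i)).trans (dist_le_pi_dist f g i)
    linarith
  exact abs_sub_le_iff.2 ⟨sub_le_comm.1 (key f g), sub_le_comm.1 (dist_comm f g ▸ key g f)⟩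

end Simplex

section AbsolutelyContinuous

variable {ι : Type*} {a b : ℝ}

theorem absolutelyContinuousOnInterval_of_dist_le {X Y : Type*} [PseudoMetricSpace X]
    [PseudoMetricSpace Y] {f : ℝ → X} {g : ℝ → Y} {C : ℝ}
    (hf : AbsolutelyContinuousOnInterval f a b)
    (h : ∀ s ∈ uIcc a b, ∀ t ∈ uIcc a b, dist (g s) (g t) ≤ C * dist (f s) (f t)) :
    AbsolutelyContinuousOnInterval g a b := by
  unfold AbsolutelyContinuousOnInterval at hf ⊢
  refine squeeze_zero' (.of_forall fun _ => Finset.sum_nonneg fun _ _ => dist_nonneg) ?_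
    (by simpa using hf.const_mul C)
  rw [eventually_inf_principal]
  filter_upwards with E hE
  rw [Finset.mul_sum]
  exact Finset.sum_le_sum fun i hi => h _ (hE.1 i hi).1 _ (hE.1 i hi).2

theorem absolutelyContinuousOnInterval_finset_sum {f : ι → ℝ → ℝ} (s : Finset ι)
    (hf : ∀ i, AbsolutelyContinuousOnInterval (f i) a b) :
    AbsolutelyContinuousOnInterval (fun t => ∑ i ∈ s, f i t) a b := by
  classical
  induction s using Finset.induction_on with
  | empty =>
    simp only [Finset.sum_empty]
    exact (LipschitzWith.const (0 : ℝ)).lipschitzOnWith.absolutelyContinuousOnInterval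
  | insert i s hi ih =>
    simp only [Finset.sum_insert hi]
    exact (hf i).fun_add ih

theorem le_of_ae_deriv_nonneg {f : ℝ → ℝ} (hab : a ≤ b)
    (hf : AbsolutelyContinuousOnInterval f a b) (h : ∀ᵐ t, t ∈ Ioo a b → 0 ≤ deriv f t) :
    f a ≤ f b := by
  rw [← sub_nonneg, ← hf.integral_deriv_eq_sub, intervalIntegral.integral_of_le hab,
    integral_Ioc_eq_integral_Ioo]
  refine setIntegral_nonneg_of_ae_restrict ?_
  rw [EventuallyLE, ae_restrict_iff' measurableSet_Ioo]
  exact h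

theorem exp_mul_le_exp_mul {f : ℝ → ℝ} (hab : a ≤ b) (hf : AbsolutelyContinuousOnInterval f a b)
    (h : ∀ᵐ t, t ∈ Ioo a b → ∃ v, 0 ≤ v ∧ HasDerivAt f (v - f t) t) :
    Real.exp a * f a ≤ Real.exp b * f b := by
  have hexp : AbsolutelyContinuousOnInterval Real.exp a b :=
    Real.contDiff_exp.contDiffOn.absolutelyContinuousOnInterval
  refine le_of_ae_deriv_nonneg hab (hexp.mul hf) ?_
  filter_upwards [h] with t ht hmem
  obtain ⟨v, hv, hd⟩ := ht hmem
  rw [((Real.hasDerivAt_exp t).mul hd).deriv, ← mul_add, add_sub_cancel]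
  positivity

theorem exists_mem_Ioo_of_ae {P : ℝ → Prop} (h : ∀ᵐ t, P t) (hab : a < b) :
    ∃ t ∈ Ioo a b, P t := by
  obtain ⟨t, ht, hmem⟩ := (Measure.dense_of_ae h).exists_between hab
  exact ⟨t, hmem, ht⟩

theorem hasDerivAt_eq_of_eventually_le {f g : ℝ → ℝ} {f' g' t : ℝ} (hf : HasDerivAt f f' t)
    (hg : HasDerivAt g g' t) (hle : ∀ᶠ s in 𝓝 t, f s ≤ g s) (heq : f t = g t) : f' = g' := by
  have hmin : IsLocalMin (fun s => g s - f s) t := by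
    filter_upwards [hle] with s hs
    simpa only [heq, sub_self, sub_nonneg] using hs
  exact (sub_eq_zero.1 (hmin.hasDerivAt_eq_zero (hg.fun_sub hf))).symm

variable [Fintype ι] {f : ℝ → ι → ℝ}

theorem absolutelyContinuousOnInterval_apply (hf : AbsolutelyContinuousOnInterval f a b) (i : ι) :
    AbsolutelyContinuousOnInterval (fun t => f t i) a b :=
  absolutelyContinuousOnInterval_of_dist_le (C := 1) hf fun s _ t _ =>
    (dist_le_pi_dist (f s) (f t) i).trans_eq (one_mul _).symm

theorem absolutelyContinuousOnInterval_pi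
    (hf : ∀ i, AbsolutelyContinuousOnInterval (fun t => f t i) a b) :
    AbsolutelyContinuousOnInterval f a b := by
  have hsum := tendsto_finsetSum Finset.univ fun i _ => hf i
  rw [Finset.sum_const_zero] at hsum
  refine squeeze_zero (fun _ => Finset.sum_nonneg fun _ _ => dist_nonneg) (fun E => ?_) hsum
  rw [Finset.sum_comm]
  refine Finset.sum_le_sum fun k _ => ?_
  refine (dist_pi_le_iff (Finset.sum_nonneg fun i _ => dist_nonneg)).2 fun i => ?_
  exact Finset.single_le_sum (f := fun i => dist (f (E.2 k).1 i) (f (E.2 k).2 i))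
    (fun _ _ => dist_nonneg) (Finset.mem_univ i)

theorem absolutelyContinuousOnInterval_ciSup [Nonempty ι]
    (hf : AbsolutelyContinuousOnInterval f a b) :
    AbsolutelyContinuousOnInterval (fun t => ⨆ i, f t i) a b :=
  absolutelyContinuousOnInterval_of_dist_le (C := 1) hf fun s _ t _ =>
    (abs_ciSup_sub_ciSup_le_dist (f s) (f t)).trans_eq (one_mul _).symm

theorem absolutelyContinuousOnInterval_ciInf [Nonempty ι]
    (hf : AbsolutelyContinuousOnInterval f a b) :
    AbsolutelyContinuousOnInterval (fun t => ⨅ i, f t i) a b :=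
  absolutelyContinuousOnInterval_of_dist_le (C := 1) hf fun s _ t _ =>
    (abs_ciInf_sub_ciInf_le_dist (f s) (f t)).trans_eq (one_mul _).symm

theorem exp_mul_apply_le_exp_mul_apply (hab : a ≤ b)
    (hf : AbsolutelyContinuousOnInterval f a b)
    (h : ∀ᵐ t, t ∈ Ioo a b → ∃ v, 0 ≤ v ∧ HasDerivAt f (v - f t) t) (i : ι) :
    Real.exp a * f a i ≤ Real.exp b * f b i := by
  refine exp_mul_le_exp_mul hab (absolutelyContinuousOnInterval_apply hf i) ?_
  filter_upwards [h] with t ht hmem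
  obtain ⟨v, hv, hd⟩ := ht hmem
  exact ⟨v i, hv i, hasDerivAt_pi.1 hd i⟩

end AbsolutelyContinuous

section DualityGap

variable {ι κ : Type*} [Fintype ι]

theorem sub_dotProduct_sq_sub_nonpos {A : AffineSubspace ℝ (ι → ℝ)} {p q y z : ι → ℝ}
    (hy : IsEnergyMinimizer A p y) (hz : IsEnergyMinimizer A q z) :
    (q - p) ⬝ᵥ (z ^ 2 - y ^ 2) ≤ 0 := by
  simp only [sub_dotProduct, dotProduct_sub]
  linarith [hy.2 z hz.1, hz.2 y hy.1]

theorem hasDerivAt_dotProduct {f g : ℝ → ι → ℝ} {f' g' : ι → ℝ} {t : ℝ} (hf : HasDerivAt f f' t)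
    (hg : HasDerivAt g g' t) :
    HasDerivAt (fun s => f s ⬝ᵥ g s) (f' ⬝ᵥ g t + f t ⬝ᵥ g') t := by
  simp only [dotProduct, ← Finset.sum_add_distrib]
  exact .fun_sum fun i _ => (hasDerivAt_pi.1 hf i).fun_mul (hasDerivAt_pi.1 hg i)

section Envelope

variable {A : AffineSubspace ℝ (ι → ℝ)} {p y : ℝ → ι → ℝ} {p' w' : ι → ℝ} {t : ℝ}

theorem dotProduct_deriv_sq_nonpos (hy : ∀ᶠ s in 𝓝 t, IsEnergyMinimizer A (p s) (y s))
    (hp' : HasDerivAt p p' t) (hw' : HasDerivAt (fun s => y s ^ 2) w' t) : p' ⬝ᵥ w' ≤ 0 := by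
  have hcont : Continuous fun w : (ι → ℝ) × (ι → ℝ) => w.1 ⬝ᵥ w.2 :=
    continuous_fst.dotProduct continuous_snd
  have hlim := (hcont.tendsto (p', w')).comp
    ((hasDerivAt_iff_tendsto_slope.1 hp').prodMk_nhds (hasDerivAt_iff_tendsto_slope.1 hw'))
  refine le_of_tendsto hlim ?_
  filter_upwards [nhdsWithin_le_nhds hy] with s hs
  simp only [Function.comp_apply, slope, vsub_eq_sub, smul_dotProduct, dotProduct_smul,
    smul_eq_mul, ← mul_assoc]
  exact mul_nonpos_of_nonneg_of_nonpos (mul_self_nonneg _)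
    (sub_dotProduct_sq_sub_nonpos hy.self_of_nhds hs)

theorem dotProduct_deriv_sq_eq_zero (hy : ∀ᶠ s in 𝓝 t, IsEnergyMinimizer A (p s) (y s))
    (hp' : HasDerivAt p p' t) (hw' : HasDerivAt (fun s => y s ^ 2) w' t) : p t ⬝ᵥ w' = 0 := by
  have htouch := hasDerivAt_eq_of_eventually_le (hasDerivAt_dotProduct hp' hw')
    (hasDerivAt_dotProduct hp' (hasDerivAt_const t (y t ^ 2)))
    (hy.mono fun s hs => hs.2 _ hy.self_of_nhds.1) rfl
  simpa using htouch

theorem hasDerivAt_minEnergy (hy : ∀ᶠ s in 𝓝 t, IsEnergyMinimizer A (p s) (y s))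
    (hp' : HasDerivAt p p' t) (hw' : HasDerivAt (fun s => y s ^ 2) w' t) :
    HasDerivAt (fun s => minEnergy A (p s)) (p' ⬝ᵥ y t ^ 2) t := by
  have h := hasDerivAt_dotProduct hp' hw'
  rw [dotProduct_deriv_sq_eq_zero hy hp' hw', add_zero] at h
  exact h.congr_of_eventuallyEq (hy.mono fun s hs => hs.minEnergy_eq)

end Envelope

variable [Fintype κ] {A : κ → AffineSubspace ℝ (ι → ℝ)}

theorem hasDerivAt_ciSup_eq [Nonempty ι] {f : ℝ → ι → ℝ} {f' q : ι → ℝ} {u' t : ℝ}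
    (hf : HasDerivAt f f' t) (hu : HasDerivAt (fun s => ⨆ i, f s i) u' t)
    (hq : q ∈ stdSimplex ℝ ι) (hmax : IsMaxOn (· ⬝ᵥ f t) (stdSimplex ℝ ι) q) :
    u' = q ⬝ᵥ f' := by
  have h := hasDerivAt_dotProduct (hasDerivAt_const t q) hf
  rw [zero_dotProduct, zero_add] at h
  exact (hasDerivAt_eq_of_eventually_le h hu (.of_forall fun s => dotProduct_le_ciSup hq (f s))
    (dotProduct_eq_ciSup hq hmax)).symm

theorem hasDerivAt_ciInf_eq [Nonempty ι] {f : ℝ → ι → ℝ} {f' q : ι → ℝ} {u' t : ℝ}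
    (hf : HasDerivAt f f' t) (hu : HasDerivAt (fun s => ⨅ i, f s i) u' t)
    (hq : q ∈ stdSimplex ℝ ι) (hmin : IsMinOn (· ⬝ᵥ f t) (stdSimplex ℝ ι) q) :
    u' = q ⬝ᵥ f' := by
  have h := hasDerivAt_dotProduct (hasDerivAt_const t q) hf
  rw [zero_dotProduct, zero_add] at h
  exact hasDerivAt_eq_of_eventually_le hu h (.of_forall fun s => ciInf_le_dotProduct hq (f s))
    (dotProduct_eq_ciInf hq hmin).symm

/-- `q` and `ν` are best replies of the two players: `q` maximizes the linearization of the payoff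
whose gradient is given by the minimizers `y`, and `ν` minimizes the payoff. -/
structure IsBestReply (A : κ → AffineSubspace ℝ (ι → ℝ)) (p : ι → ℝ) (μ : κ → ℝ)
    (y : κ → ι → ℝ) (q : ι → ℝ) (ν : κ → ℝ) : Prop where
  mem_left : q ∈ stdSimplex ℝ ι
  mem_right : ν ∈ stdSimplex ℝ κ
  isMaxOn : IsMaxOn (· ⬝ᵥ mixedGradient μ y) (stdSimplex ℝ ι) q
  isMinOn : IsMinOn (· ⬝ᵥ fun x => minEnergy (A x) p) (stdSimplex ℝ κ) ν

/-- The duality gap at `(p, μ)`, where `y x` is the minimizer over `A x`: an upper bound minus a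
lower bound for the value of the game. -/
noncomputable def dualityGap (A : κ → AffineSubspace ℝ (ι → ℝ)) (p : ι → ℝ) (μ : κ → ℝ)
    (y : κ → ι → ℝ) : ℝ :=
  (⨆ i, mixedGradient μ y i) - ⨅ x, minEnergy (A x) p

theorem dualityGap_le [Nonempty ι] {p : ι → ℝ} {μ : κ → ℝ} {y : κ → ι → ℝ} {R : ℝ} (hp : 0 ≤ p)
    (hμ : μ ∈ stdSimplex ℝ κ) (hy : ∀ x i, y x i ^ 2 ≤ R) : dualityGap A p μ y ≤ R := by
  have hlower : 0 ≤ ⨅ x, minEnergy (A x) p := Real.iInf_nonneg fun x => minEnergy_nonneg (A x) hp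
  refine (sub_le_self _ hlower).trans (ciSup_le fun i => ?_)
  have hterm : mixedGradient μ y i = μ ⬝ᵥ fun x => y x i ^ 2 := by
    simp [mixedGradient, dotProduct]
  have : Nonempty κ := ⟨(exists_pos_of_mem_stdSimplex hμ).choose⟩
  exact hterm.trans_le ((dotProduct_le_ciSup hμ _).trans (ciSup_le fun x => hy x i))

theorem dualityGap_deriv_le [Nonempty ι] [Nonempty κ] {p : ℝ → ι → ℝ} {μ : ℝ → κ → ℝ}
    {y : ℝ → κ → ι → ℝ} {q : ι → ℝ} {ν : κ → ℝ} {w' : κ → ι → ℝ} {u' l' t : ℝ}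
    (hμ : 0 ≤ μ t) (hy : ∀ x, ∀ᶠ s in 𝓝 t, IsEnergyMinimizer (A x) (p s) (y s x))
    (hbest : IsBestReply A (p t) (μ t) (y t) q ν)
    (hp' : HasDerivAt p (q - p t) t) (hμ' : HasDerivAt μ (ν - μ t) t)
    (hw' : ∀ x, HasDerivAt (fun s => y s x ^ 2) (w' x) t)
    (hu' : HasDerivAt (fun s => ⨆ i, mixedGradient (μ s) (y s) i) u' t)
    (hl' : HasDerivAt (fun s => ⨅ x, minEnergy (A x) (p s)) l' t) :
    u' - l' ≤ -dualityGap A (p t) (μ t) (y t) := by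
  have hcurv : ∑ x, μ t x * q ⬝ᵥ w' x ≤ 0 := Finset.sum_nonpos fun x _ => by
    have hneg := dotProduct_deriv_sq_nonpos (hy x) hp' (hw' x)
    rw [sub_dotProduct, dotProduct_deriv_sq_eq_zero (hy x) hp' (hw' x), sub_zero] at hneg
    exact mul_nonpos_of_nonneg_of_nonpos (hμ x) hneg
  have hupper : u' = q ⬝ᵥ mixedGradient ν (y t) - (⨆ i, mixedGradient (μ t) (y t) i) +
      ∑ x, μ t x * q ⬝ᵥ w' x := by
    rw [hasDerivAt_ciSup_eq (hasDerivAt_mixedGradient hμ' hw') hu' hbest.mem_left hbest.isMaxOn,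
      mixedGradient_sub, dotProduct_add, dotProduct_sub,
      dotProduct_eq_ciSup hbest.mem_left hbest.isMaxOn, dotProduct_sum]
    simp only [dotProduct_smul, smul_eq_mul]
  have hlower : l' = q ⬝ᵥ mixedGradient ν (y t) - ⨅ x, minEnergy (A x) (p t) := by
    rw [hasDerivAt_ciInf_eq (f := fun s x => minEnergy (A x) (p s))
      (hasDerivAt_pi.2 fun x => hasDerivAt_minEnergy (hy x) hp' (hw' x)) hl' hbest.mem_right
      hbest.isMinOn, ← dotProduct_eq_ciInf hbest.mem_right hbest.isMinOn, dotProduct_mixedGradient]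
    simp only [dotProduct, ← Finset.sum_sub_distrib, ← mul_sub]
    refine Finset.sum_congr rfl fun x _ => ?_
    rw [(hy x).self_of_nhds.minEnergy_eq, dotProduct, ← Finset.sum_sub_distrib]
    simp only [Pi.sub_apply, sub_mul]
  rw [dualityGap]
  linarith

end DualityGap

section BestReplyPath

variable {ι κ : Type*} [Fintype ι] [Fintype κ] {A : κ → AffineSubspace ℝ (ι → ℝ)}
  {p : ℝ → ι → ℝ} {μ : ℝ → κ → ℝ} {y : ℝ → κ → ι → ℝ} {a b : ℝ}

/-- `(p, μ)` follows the best-reply dynamics on `[a, b]`, and `y t x` is a regular minimizer over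
`A x` for the weights `p t`. -/
structure IsBestReplyPath (A : κ → AffineSubspace ℝ (ι → ℝ)) (p : ℝ → ι → ℝ) (μ : ℝ → κ → ℝ)
    (y : ℝ → κ → ι → ℝ) (a b : ℝ) : Prop where
  le : a ≤ b
  nonneg_left : ∀ t ∈ Icc a b, 0 ≤ p t
  nonneg_right : ∀ t ∈ Icc a b, 0 ≤ μ t
  isRegularMinimizer : ∀ t ∈ Icc a b, ∀ x, IsRegularMinimizer (A x) (p t) (y t x)
  absolutelyContinuous_left : AbsolutelyContinuousOnInterval p a b
  absolutelyContinuous_right : AbsolutelyContinuousOnInterval μ a b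
  ae_hasDerivAt : ∀ᵐ t, t ∈ Ioo a b → ∃ q ν, IsBestReply A (p t) (μ t) (y t) q ν ∧
    HasDerivAt p (q - p t) t ∧ HasDerivAt μ (ν - μ t) t

namespace IsBestReplyPath

theorem exp_smul_le (h : IsBestReplyPath A p μ y a b) {t : ℝ} (ht : t ∈ Icc a b) :
    Real.exp (a - b) • p a ≤ p t := by
  intro i
  have hgrow := exp_mul_apply_le_exp_mul_apply ht.1
    (h.absolutelyContinuous_left.mono (uIcc_subset_uIcc left_mem_uIcc (Icc_subset_uIcc ht))) (by
      filter_upwards [h.ae_hasDerivAt] with s hs hmem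
      obtain ⟨q, ν, hbest, hp', -⟩ := hs ⟨hmem.1, hmem.2.trans_le ht.2⟩
      exact ⟨q, hbest.mem_left.1, hp'⟩) i
  calc Real.exp (a - b) * p a i ≤ Real.exp (a - t) * p a i :=
        mul_le_mul_of_nonneg_right (Real.exp_le_exp.2 (sub_le_sub_left ht.2 a))
          (h.nonneg_left a (left_mem_Icc.2 h.le) i)
    _ ≤ p t i := by
        rwa [Real.exp_sub, div_mul_eq_mul_div, div_le_iff₀' (Real.exp_pos t)]

theorem exists_coercive (h : IsBestReplyPath A p μ y a b) {x : κ}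
    (hcoer : ∀ z ∈ (A x).direction, p a ⬝ᵥ z ^ 2 = 0 → z = 0) :
    ∃ c > 0, ∀ t ∈ Icc a b, ∀ z ∈ (A x).direction, c * ‖z‖ ^ 2 ≤ p t ⬝ᵥ z ^ 2 := by
  obtain ⟨c, hc, hle⟩ :=
    exists_mul_norm_sq_le_dotProduct_sq (h.nonneg_left a (left_mem_Icc.2 h.le)) hcoer
  refine ⟨Real.exp (a - b) * c, by positivity, fun t ht z hz => ?_⟩
  calc Real.exp (a - b) * c * ‖z‖ ^ 2 ≤ Real.exp (a - b) * (p a ⬝ᵥ z ^ 2) := by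
        rw [mul_assoc]
        exact mul_le_mul_of_nonneg_left (hle z hz) (Real.exp_pos _).le
    _ = (Real.exp (a - b) • p a) ⬝ᵥ z ^ 2 := by rw [smul_dotProduct, smul_eq_mul]
    _ ≤ p t ⬝ᵥ z ^ 2 := dotProduct_le_dotProduct_of_nonneg_right (h.exp_smul_le ht)
        fun i => sq_nonneg (z i)

theorem absolutelyContinuous_minimizer (h : IsBestReplyPath A p μ y a b) {x : κ}
    (hcoer : ∀ z ∈ (A x).direction, p a ⬝ᵥ z ^ 2 = 0 → z = 0) :
    AbsolutelyContinuousOnInterval (fun t => y t x) a b := by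
  obtain ⟨c, hc, hle⟩ := h.exists_coercive hcoer
  obtain ⟨R, hR⟩ := exists_norm_le_of_isRegularMinimizer (A x)
  refine absolutelyContinuousOnInterval_of_dist_le (C := Fintype.card ι * R / c)
    h.absolutelyContinuous_left fun s hs t ht => ?_
  rw [uIcc_of_le h.le] at hs ht
  rw [dist_eq_norm, dist_eq_norm, div_mul_eq_mul_div, le_div_iff₀' hc]
  refine ((h.isRegularMinimizer t ht x).isEnergyMinimizer.mul_norm_sub_le
    (h.isRegularMinimizer s hs x).isEnergyMinimizer (hle t ht)).trans ?_
  gcongr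
  exact hR _ _ (h.isRegularMinimizer s hs x)

theorem absolutelyContinuous_sq (h : IsBestReplyPath A p μ y a b) {x : κ}
    (hcoer : ∀ z ∈ (A x).direction, p a ⬝ᵥ z ^ 2 = 0 → z = 0) (i : ι) :
    AbsolutelyContinuousOnInterval (fun t => y t x i ^ 2) a b := by
  have hy := absolutelyContinuousOnInterval_apply (h.absolutelyContinuous_minimizer hcoer) i
  simpa only [sq] using hy.fun_mul hy

theorem absolutelyContinuous_mixedGradient (h : IsBestReplyPath A p μ y a b)
    (hcoer : ∀ x, ∀ z ∈ (A x).direction, p a ⬝ᵥ z ^ 2 = 0 → z = 0) :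
    AbsolutelyContinuousOnInterval (fun t => mixedGradient (μ t) (y t)) a b := by
  refine absolutelyContinuousOnInterval_pi fun i => ?_
  simp only [mixedGradient, Finset.sum_apply, Pi.smul_apply, Pi.pow_apply, smul_eq_mul]
  exact absolutelyContinuousOnInterval_finset_sum _ fun x =>
    (absolutelyContinuousOnInterval_apply h.absolutelyContinuous_right x).fun_mul
      (h.absolutelyContinuous_sq (hcoer x) i)

theorem absolutelyContinuous_minEnergy (h : IsBestReplyPath A p μ y a b) :
    AbsolutelyContinuousOnInterval (fun t x => minEnergy (A x) (p t)) a b := by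
  have ha : a ∈ Icc a b := left_mem_Icc.2 h.le
  refine absolutelyContinuousOnInterval_pi fun x => ?_
  obtain ⟨C, hC⟩ := exists_lipschitzOnWith_minEnergy
    ⟨y a x, (h.isRegularMinimizer a ha x).isEnergyMinimizer.1⟩
  refine absolutelyContinuousOnInterval_of_dist_le (C := C)
    h.absolutelyContinuous_left fun s hs t ht => ?_
  rw [uIcc_of_le h.le] at hs ht
  exact hC.dist_le_mul _ (h.nonneg_left s hs) _ (h.nonneg_left t ht)

theorem exp_mul_dualityGap_le [Nonempty ι] [Nonempty κ] (h : IsBestReplyPath A p μ y a b)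
    (hcoer : ∀ x, ∀ z ∈ (A x).direction, p a ⬝ᵥ z ^ 2 = 0 → z = 0) :
    Real.exp b * dualityGap A (p b) (μ b) (y b) ≤ Real.exp a * dualityGap A (p a) (μ a) (y a) := by
  have hU := absolutelyContinuousOnInterval_ciSup (h.absolutelyContinuous_mixedGradient hcoer)
  have hL := absolutelyContinuousOnInterval_ciInf h.absolutelyContinuous_minEnergy
  have hsq : ∀ᵐ t : ℝ, ∀ x i, t ∈ uIcc a b → DifferentiableAt ℝ (fun s => y s x i ^ 2) t :=
    ae_all_iff.2 fun x => ae_all_iff.2 fun i =>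
      (h.absolutelyContinuous_sq (hcoer x) i).ae_differentiableAt
  have hmain := exp_mul_le_exp_mul h.le (hL.fun_sub hU) ?_
  · simp only [dualityGap]
    linarith
  filter_upwards [h.ae_hasDerivAt, hsq, hU.ae_differentiableAt, hL.ae_differentiableAt]
    with t hpath hsq hu hl ht
  have htI : t ∈ uIcc a b := by rw [uIcc_of_le h.le]; exact Ioo_subset_Icc_self ht
  obtain ⟨q, ν, hbest, hp', hμ'⟩ := hpath ht
  have hgap := dualityGap_deriv_le (h.nonneg_right t (Ioo_subset_Icc_self ht))
    (fun x => eventually_of_mem (Ioo_mem_nhds ht.1 ht.2) fun s hs =>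
      (h.isRegularMinimizer s (Ioo_subset_Icc_self hs) x).isEnergyMinimizer)
    hbest hp' hμ' (fun x => hasDerivAt_pi.2 fun i => (hsq x i htI).hasDerivAt)
    (hu htI).hasDerivAt (hl htI).hasDerivAt
  refine ⟨_, ?_, ((hl htI).hasDerivAt.fun_sub (hu htI).hasDerivAt).congr_deriv
    (add_sub_cancel_right _ _).symm⟩
  rw [dualityGap] at hgap
  linarith

end IsBestReplyPath

end BestReplyPath

section Saddle

variable {ι κ : Type*} [Fintype ι] [Fintype κ] {A : κ → AffineSubspace ℝ (ι → ℝ)}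

theorem abs_mixedEnergy_sub_le_dualityGap {p pstar : ι → ℝ} {μ mustar : κ → ℝ} {y : κ → ι → ℝ}
    (hp : p ∈ stdSimplex ℝ ι) (hμ : μ ∈ stdSimplex ℝ κ) (hpstar : pstar ∈ stdSimplex ℝ ι)
    (hmustar : mustar ∈ stdSimplex ℝ κ)
    (hmax : IsMaxOn (mixedEnergy A mustar) (stdSimplex ℝ ι) pstar)
    (hmin : IsMinOn (fun ν => mixedEnergy A ν pstar) (stdSimplex ℝ κ) mustar)
    (hy : ∀ x, IsEnergyMinimizer (A x) p (y x)) :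
    |mixedEnergy A μ p - mixedEnergy A mustar pstar| ≤ dualityGap A p μ y := by
  have hlower := ciInf_le_dotProduct hμ fun x => minEnergy (A x) p
  have hupper := (mixedEnergy_eq hy).trans_le (dotProduct_le_ciSup hp (mixedGradient μ y))
  have hlower' := (ciInf_le_dotProduct hmustar fun x => minEnergy (A x) p).trans (hmax hp)
  have hupper' := (hmin hμ).trans ((mixedEnergy_le hpstar.1 hμ.1 fun x => (hy x).1).trans
    (dotProduct_le_ciSup hpstar (mixedGradient μ y)))
  exact abs_sub_le_iff.2 ⟨sub_le_sub hupper hlower', sub_le_sub hupper' hlower⟩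

theorem concaveOn_mixedEnergy (hA : ∀ x, (A x : Set (ι → ℝ)).Nonempty) {μ : κ → ℝ} (hμ : 0 ≤ μ) :
    ConcaveOn ℝ (Ici 0) (mixedEnergy A μ) := by
  refine ⟨convex_Ici 0, fun p hp q hq s t hs ht hst => ?_⟩
  simp only [mixedEnergy, Finset.smul_sum, ← Finset.sum_add_distrib]
  exact Finset.sum_le_sum fun x _ =>
    ((concaveOn_minEnergy (hA x)).smul (hμ x)).2 hp hq hs ht hst

theorem exists_isSaddlePoint_mixedEnergy [Nonempty ι] [Nonempty κ]
    (hA : ∀ x, (A x : Set (ι → ℝ)).Nonempty) :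
    ∃ p ∈ stdSimplex ℝ ι, ∃ μ ∈ stdSimplex ℝ κ,
      IsMaxOn (mixedEnergy A μ) (stdSimplex ℝ ι) p ∧
      IsMinOn (fun ν => mixedEnergy A ν p) (stdSimplex ℝ κ) μ := by
  classical
  have hsub : stdSimplex ℝ ι ⊆ Ici 0 := fun p hp => hp.1
  have hcont : ∀ x, ContinuousOn (minEnergy (A x)) (Ici 0) := fun x =>
    (exists_lipschitzOnWith_minEnergy (hA x)).choose_spec.continuousOn
  obtain ⟨μ, hμ, p, hp, hsad⟩ := Sion.exists_isSaddlePointOn (X := stdSimplex ℝ κ)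
    (Y := stdSimplex ℝ ι) (f := fun μ p => mixedEnergy A μ p)
    ⟨_, single_mem_stdSimplex ℝ (Classical.arbitrary κ)⟩ (convex_stdSimplex ℝ _)
    (isCompact_stdSimplex ℝ _)
    (fun p _ => ContinuousOn.lowerSemicontinuousOn (by unfold mixedEnergy; fun_prop))
    (fun p _ => (((dotCLM fun x => minEnergy (A x) p).toLinearMap.convexOn
      (convex_stdSimplex ℝ κ)).congr fun μ _ => dotCLM_apply _ μ).quasiconvexOn)
    (convex_stdSimplex ℝ _) ⟨_, single_mem_stdSimplex ℝ (Classical.arbitrary ι)⟩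
    (isCompact_stdSimplex ℝ _)
    (fun μ _ => ContinuousOn.upperSemicontinuousOn <| continuousOn_finsetSum _ fun x _ =>
      continuousOn_const.mul ((hcont x).mono hsub))
    (fun μ hμ => ((concaveOn_mixedEnergy hA hμ.1).subset hsub
      (convex_stdSimplex ℝ _)).quasiconcaveOn)
  exact ⟨p, hp, μ, hμ, fun q hq => hsad μ hμ q hq, fun ν hν => hsad ν hν p hp⟩

end Saddle

section Staircase

variable {α : Type*} [PartialOrder α] {f : ℝ → α} {s T : ℝ}

/-- Along the times `0 ≤ t`, the function `f` takes the increasing values `v 0, …, v n = b`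
successively: after its value at `0`, it takes the value `v l` on `(τ l, τ (l + 1)]`, where `τ 1`
may be `0`, and the value `b` after `τ n`. -/
structure IsStaircase (f : ℝ → α) (b : α) (n : ℕ) (v : ℕ → α) (τ : ℕ → ℝ) : Prop where
  value_zero : v 0 = f 0
  value_lt : ∀ l < n, v l < v (l + 1)
  value_last : v n = b
  time_zero : τ 0 = 0
  time_nonneg : ∀ l, 0 ≤ τ l
  time_lt : ∀ l, 1 ≤ l → l < n → τ l < τ (l + 1)
  apply_time : ∀ l < n, f (τ (l + 1)) = v l
  eq_of_mem_Ioc : ∀ l < n, ∀ t ∈ Ioc (τ l) (τ (l + 1)), f t = v l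
  eq_of_lt : ∀ t, τ n < t → f t = b

theorem IsStaircase.value_lt_last {b : α} {n : ℕ} {v : ℕ → α} {τ : ℕ → ℝ}
    (h : IsStaircase f b n v τ) : ∀ l < n, v l < b := fun _ hl =>
  (strictMonoOn_Iic_of_lt_succ h.value_lt hl.le self_mem_Iic hl).trans_eq h.value_last

theorem isGreatest_sSup_apply_le (hmono : MonotoneOn f (Ici 0))
    (hleft : ∀ t > 0, ∃ s ∈ Ico 0 t, f s = f t) (hs : 0 ≤ s) (hT : 0 ≤ T) (hlt : f s < f T) :
    IsGreatest {t | 0 ≤ t ∧ f t ≤ f s} (sSup {t | 0 ≤ t ∧ f t ≤ f s}) := by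
  set J : Set ℝ := {t | 0 ≤ t ∧ f t ≤ f s}
  have hsJ : s ∈ J := ⟨hs, le_rfl⟩
  have hbdd : BddAbove J := by
    refine ⟨T, fun t ht => ?_⟩
    exact (hmono.reflect_lt ht.1 hT (ht.2.trans_lt hlt)).le
  refine ⟨?_, fun t ht => le_csSup hbdd ht⟩
  rcases (hs.trans (le_csSup hbdd hsJ)).eq_or_lt with hzero | hpos
  · exact ⟨hzero.le, hzero ▸ hmono self_mem_Ici hs hs⟩
  · obtain ⟨r, hr, hfr⟩ := hleft _ hpos
    obtain ⟨t, ht, hrt⟩ := exists_lt_of_lt_csSup ⟨s, hsJ⟩ hr.2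
    exact ⟨hpos.le, hfr ▸ (hmono hr.1 ht.1 hrt.le).trans ht.2⟩

theorem le_apply_of_covBy (hmono : MonotoneOn f (Ici 0)) {a b : f '' Ici 0} (hab : a ⋖ b)
    (hs : IsGreatest {t | 0 ≤ t ∧ f t ≤ a} s) {t : ℝ} (hst : s < t) : (b : α) ≤ f t := by
  have ht : 0 ≤ t := hs.1.1.trans hst.le
  let c : f '' Ici 0 := ⟨f t, t, ht, rfl⟩
  have htotal : ∀ e : f '' Ici 0, e ≤ c ∨ c ≤ e := by
    rintro ⟨-, r, hr, rfl⟩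
    exact (le_total r t).imp (hmono hr ht) (hmono ht hr)
  have hnot : ¬ c ≤ a := fun hle => hst.not_ge (hs.2 ⟨ht, hle⟩)
  have hac : a < c := ((htotal a).resolve_right hnot).lt_of_not_ge hnot
  exact (htotal b).elim id fun hcb => (hcb.eq_of_not_lt (hab.2 hac)).ge

theorem isStaircase_of_covBy (hmono : MonotoneOn f (Ici 0)) {n : ℕ} {w : ℕ → f '' Ici 0}
    {τ : ℕ → ℝ} (hw0 : (w 0 : α) = f 0) (hcov : ∀ l < n, w l ⋖ w (l + 1))
    (hwn : ∀ t, 0 ≤ t → f t ≤ w n) (hτ0 : τ 0 = 0) (hτ : ∀ l, 0 ≤ τ l)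
    (hgreatest : ∀ l < n, IsGreatest {t | 0 ≤ t ∧ f t ≤ w l} (τ (l + 1))) :
    IsStaircase f (w n) n (fun l => w l) τ := by
  have hle : ∀ l ≤ n, ∀ t, τ l < t → (w l : α) ≤ f t
    | 0, _, t, ht => hw0 ▸ hmono self_mem_Ici (hτ0 ▸ ht.le) (hτ0 ▸ ht.le)
    | l + 1, hl, t, ht => le_apply_of_covBy hmono (hcov l hl) (hgreatest l hl) ht
  have happly : ∀ l < n, f (τ (l + 1)) = w l := fun l hl => by
    obtain ⟨s, hs, hsl⟩ := (w l).2
    exact (hgreatest l hl).1.2.antisymm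
      (hsl ▸ hmono hs (hτ _) ((hgreatest l hl).2 ⟨hs, hsl.le⟩))
  refine ⟨hw0, fun l hl => (hcov l hl).1, rfl, hτ0, hτ, ?_, happly, ?_, ?_⟩
  · rintro (_ | l) h1 hl
    · exact absurd h1 (by lia)
    · refine hmono.reflect_lt (hτ _) (hτ _) ?_
      rw [happly l (by lia), happly (l + 1) hl]
      exact (hcov l (by lia)).1
  · intro l hl t ht
    refine le_antisymm ?_ (hle l hl.le t ht.1)
    rw [← happly l hl]
    exact hmono ((hτ l).trans ht.1.le) (hτ _) ht.2
  · exact fun t ht => le_antisymm (hwn t ((hτ n).trans ht.le)) (hle n le_rfl t ht)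

theorem exists_isStaircase [WellFoundedLT α] [WellFoundedGT α] (hmono : MonotoneOn f (Ici 0))
    (hleft : ∀ t > 0, ∃ s ∈ Ico 0 t, f s = f t) (hT : 0 ≤ T) (hle : ∀ t, 0 ≤ t → f t ≤ f T) :
    ∃ n v τ, IsStaircase f (f T) n v τ := by
  -- The covering relation is taken among the values of `f`, so that none of them is skipped.
  obtain ⟨w, hw0, n, hwn, hcov⟩ := exists_covBy_seq_of_wellFoundedLT_wellFoundedGT_of_le
    (α := f '' Ici 0) (x := ⟨f 0, mem_image_of_mem f self_mem_Ici⟩) (y := ⟨f T, T, hT, rfl⟩)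
    (hle 0 le_rfl)
  have hv0 : (w 0 : α) = f 0 := congrArg Subtype.val hw0
  have hvn : (w n : α) = f T := congrArg Subtype.val hwn
  obtain ⟨τ, hτ0, hτ⟩ : ∃ τ : ℕ → ℝ, τ 0 = 0 ∧ ∀ l, τ (l + 1) = sSup {t | 0 ≤ t ∧ f t ≤ w l} :=
    ⟨fun | 0 => 0 | l + 1 => sSup {t | 0 ≤ t ∧ f t ≤ w l}, rfl, fun _ => rfl⟩
  have hnonneg : ∀ l, 0 ≤ τ l
    | 0 => hτ0.ge
    | l + 1 => (hτ l).symm ▸ Real.sSup_nonneg fun _ ht => ht.1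
  refine ⟨n, fun l => w l, τ, hvn ▸
    isStaircase_of_covBy hmono hv0 hcov (hvn ▸ hle) hτ0 hnonneg fun l hl => ?_⟩
  have hlt : w l < w n :=
    strictMonoOn_Iic_of_lt_succ (fun l hl => (hcov l hl).1) hl.le self_mem_Iic hl
  rw [hwn] at hlt
  obtain ⟨s, hs, hsl⟩ := (w l).2
  rw [hτ, ← hsl]
  exact isGreatest_sSup_apply_le hmono hleft hs hT (hsl.trans_lt hlt)

end Staircase

namespace LinearBandit

section LeastSquares

variable {K d : ℕ} (B : LinearBandit K d)

/-- The normalised mean shifts `h ↦ (⟨a i, h⟩ / (√2 σ i))_i`. With this normalisation `info p ϑ` is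
the energy `p ⬝ᵥ y ^ 2` of the shift `y` of the difference `θ - ϑ`. -/
noncomputable def response : EuclideanSpace ℝ (Fin d) →ₗ[ℝ] Fin K → ℝ :=
  LinearMap.pi fun i => (√2 * (B.σ i : ℝ))⁻¹ • (innerₛₗ ℝ (B.a i))

/-- The gap `⟨δ_x, θ⟩` between the mean of the best arm and that of `x`. -/
noncomputable def gap (x : B.Scenario) : ℝ := inner ℝ (B.delta x) B.θ

/-- The responses to `θ - ϑ`, where `ϑ` runs over the parameters at which the arm `x` ties with the
best one. -/
noncomputable def slice (x : B.Scenario) : AffineSubspace ℝ (Fin K → ℝ) :=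
  (AffineSubspace.mk' B.θ (ℝ ∙ B.delta x)ᗮ).map B.response.toAffineMap

variable {B}

theorem coe_σ_pos (i : Fin K) : (0 : ℝ) < B.σ i := B.σ_pos i

theorem response_apply (h : EuclideanSpace ℝ (Fin d)) (i : Fin K) :
    B.response h i = inner ℝ (B.a i) h / (√2 * B.σ i) := by
  simp [response, div_eq_inv_mul]

theorem response_apply_sq (h : EuclideanSpace ℝ (Fin d)) (i : Fin K) :
    B.response h i ^ 2 = inner ℝ (B.a i) h ^ 2 / (2 * B.σ i ^ 2) := by
  rw [response_apply, div_pow, mul_pow, Real.sq_sqrt zero_le_two]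

theorem response_apply_eq_zero_iff {h : EuclideanSpace ℝ (Fin d)} {i : Fin K} :
    B.response h i = 0 ↔ inner ℝ (B.a i) h = 0 := by
  have := coe_σ_pos (B := B) i
  rw [response_apply, div_eq_zero_iff, or_iff_left (by positivity)]

theorem info_eq_dotProduct (p : Fin K → ℝ) (ϑ : EuclideanSpace ℝ (Fin d)) :
    B.info p ϑ = p ⬝ᵥ B.response (B.θ - ϑ) ^ 2 := by
  refine Finset.sum_congr rfl fun i _ => ?_
  rw [armLaw, armLaw, toReal_klDiv_gaussianReal _ _ (pow_ne_zero 2 (B.σ_pos i).ne'),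
    Pi.pow_apply, response_apply_sq, inner_sub_right, NNReal.coe_pow]

theorem gap_pos (x : B.Scenario) : 0 < B.gap x := by
  rw [gap, delta, inner_sub_left, sub_pos]
  exact B.best_unique x x.2

theorem mem_alt_iff {x : B.Scenario} {ϑ : EuclideanSpace ℝ (Fin d)} :
    ϑ ∈ B.alt x ↔ B.gap x < inner ℝ (B.delta x) (B.θ - ϑ) := by
  rw [inner_sub_right, gap, delta, inner_sub_left _ _ ϑ, lt_sub_comm, sub_self, sub_neg]
  exact Iff.rfl

theorem mem_slice_iff {x : B.Scenario} {y : Fin K → ℝ} :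
    y ∈ B.slice x ↔ ∃ h, inner ℝ (B.delta x) h = B.gap x ∧ B.response h = y := by
  simp only [slice, AffineSubspace.mem_map, AffineSubspace.mem_mk', vsub_eq_sub,
    Submodule.mem_orthogonal_singleton_iff_inner_right, inner_sub_right, sub_eq_zero, gap,
    LinearMap.coe_toAffineMap]

theorem slice_nonempty (x : B.Scenario) : (B.slice x : Set (Fin K → ℝ)).Nonempty :=
  ⟨_, mem_slice_iff.2 ⟨B.θ, rfl, rfl⟩⟩

theorem direction_slice_le (x : B.Scenario) :
    (B.slice x).direction ≤ LinearMap.range B.response := by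
  rw [slice, AffineSubspace.map_direction]
  exact LinearMap.map_le_range

theorem minEnergy_slice_le_info {p : Fin K → ℝ} (hp : 0 ≤ p) {x : B.Scenario}
    {ϑ : EuclideanSpace ℝ (Fin d)} (hϑ : ϑ ∈ B.alt x) :
    minEnergy (B.slice x) p ≤ B.info p ϑ := by
  rw [info_eq_dotProduct]
  set h := B.θ - ϑ
  set s := inner ℝ (B.delta x) h
  have hs : B.gap x < s := mem_alt_iff.1 hϑ
  have hs0 : 0 < s := (gap_pos x).trans hs
  have hmem : B.response ((B.gap x / s) • h) ∈ B.slice x :=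
    mem_slice_iff.2 ⟨_, by rw [inner_smul_right]; exact div_mul_cancel₀ _ hs0.ne', rfl⟩
  refine (minEnergy_le hp hmem).trans ?_
  rw [map_smul, dotProduct_smul_sq]
  exact mul_le_of_le_one_left (dotProduct_sq_nonneg hp _)
    (pow_le_one₀ (div_nonneg (gap_pos x).le hs0.le) ((div_le_one hs0).2 hs.le))

theorem sub_smul_mem_alt {x : B.Scenario} {h : EuclideanSpace ℝ (Fin d)}
    (hh : inner ℝ (B.delta x) h = B.gap x) {t : ℝ} (ht : 1 < t) : B.θ - t • h ∈ B.alt x := by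
  rw [mem_alt_iff, sub_sub_cancel, inner_smul_right, hh]
  exact lt_mul_of_one_lt_left (gap_pos x) ht

theorem D_eq_minEnergy {p : Fin K → ℝ} (hp : 0 ≤ p) (x : B.Scenario) :
    B.D p x = minEnergy (B.slice x) p := by
  obtain ⟨y, hy⟩ := exists_isRegularMinimizer (slice_nonempty x) hp
  refine IsGLB.csInf_eq ⟨forall_mem_image.2 fun ϑ => minEnergy_slice_le_info hp, fun b hb => ?_⟩
    (Nonempty.image _ ⟨_, sub_smul_mem_alt (h := B.θ) rfl one_lt_two⟩)
  obtain ⟨h, hh, rfl⟩ := mem_slice_iff.1 hy.isEnergyMinimizer.1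
  have hle : ∀ t : ℝ, 1 < t → b ≤ t ^ 2 * p ⬝ᵥ B.response h ^ 2 := fun t ht => by
    have := hb (mem_image_of_mem (B.info p) (sub_smul_mem_alt hh ht))
    rwa [info_eq_dotProduct, sub_sub_cancel, map_smul, dotProduct_smul_sq] at this
  have hlim : Tendsto (fun t : ℝ => t ^ 2 * p ⬝ᵥ B.response h ^ 2) (𝓝[>] 1)
      (𝓝 (1 ^ 2 * p ⬝ᵥ B.response h ^ 2)) :=
    (Continuous.tendsto (by fun_prop) 1).mono_left nhdsWithin_le_nhds
  rw [hy.isEnergyMinimizer.minEnergy_eq]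
  simpa using ge_of_tendsto hlim (eventually_mem_nhdsWithin.mono hle)

theorem F_eq_mixedEnergy {p : Fin K → ℝ} (hp : 0 ≤ p) (μ : B.Scenario → ℝ) :
    B.F p μ = mixedEnergy B.slice μ p :=
  Finset.sum_congr rfl fun x _ => by rw [D_eq_minEnergy hp]

theorem D_nonneg {p : Fin K → ℝ} (hp : 0 ≤ p) (x : B.Scenario) : 0 ≤ B.D p x :=
  (minEnergy_nonneg _ hp).trans_eq (D_eq_minEnergy hp x).symm

end LeastSquares

section Span

variable {K d : ℕ} {B : LinearBandit K d} {p q : Fin K → ℝ}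

theorem a_mem_fullSpan (i : Fin K) : B.a i ∈ B.fullSpan := Submodule.subset_span ⟨i, rfl⟩

theorem delta_mem_fullSpan (x : B.Scenario) : B.delta x ∈ B.fullSpan :=
  sub_mem (a_mem_fullSpan _) (a_mem_fullSpan _)

theorem a_mem_activeSpan {i : Fin K} (hi : 0 < p i) : B.a i ∈ B.activeSpan p :=
  Submodule.subset_span ⟨i, hi, rfl⟩

theorem activeSpan_le_fullSpan (p : Fin K → ℝ) : B.activeSpan p ≤ B.fullSpan :=
  Submodule.span_mono (image_subset_range _ _)

theorem activeSpan_mono (h : ∀ i, 0 < p i → 0 < q i) : B.activeSpan p ≤ B.activeSpan q :=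
  Submodule.span_mono (image_mono h)

theorem fullSpan_le {S : Submodule ℝ (EuclideanSpace ℝ (Fin d))} (h : ∀ i, B.a i ∈ S) :
    B.fullSpan ≤ S :=
  Submodule.span_le.2 (range_subset_iff.2 h)

theorem activeSpan_of_pos (hp : ∀ i, 0 < p i) : B.activeSpan p = B.fullSpan :=
  (activeSpan_le_fullSpan p).antisymm (fullSpan_le fun i => a_mem_activeSpan (hp i))

theorem mem_orthogonal_activeSpan_iff {h : EuclideanSpace ℝ (Fin d)} :
    h ∈ (B.activeSpan p)ᗮ ↔ ∀ i, 0 < p i → B.response h i = 0 := by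
  simp only [response_apply_eq_zero_iff]
  refine ⟨fun hh i hi => hh _ (a_mem_activeSpan hi), fun hh => ?_⟩
  have hle : B.activeSpan p ≤ (ℝ ∙ h)ᗮ := by
    refine Submodule.span_le.2 (forall_mem_image.2 fun i hi => ?_)
    exact Submodule.mem_orthogonal_singleton_iff_inner_left.2 (hh i hi)
  exact fun v hv => Submodule.mem_orthogonal_singleton_iff_inner_left.1 (hle hv)

theorem eq_zero_of_mem_direction_slice (hp : 0 ≤ p) (hS : B.activeSpan p = B.fullSpan)
    {x : B.Scenario} {z : Fin K → ℝ} (hz : z ∈ (B.slice x).direction) (h0 : p ⬝ᵥ z ^ 2 = 0) :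
    z = 0 := by
  obtain ⟨h, rfl⟩ := direction_slice_le x hz
  have hh := mem_orthogonal_activeSpan_iff.2 ((dotProduct_sq_eq_zero_iff hp).1 h0)
  ext i
  exact response_apply_eq_zero_iff.2 (hh _ (hS ▸ a_mem_fullSpan i))

theorem D_eq_zero_iff (hp : 0 ≤ p) {x : B.Scenario} :
    B.D p x = 0 ↔ B.delta x ∉ B.activeSpan p := by
  have hiff : B.D p x = 0 ↔ ∃ h ∈ (B.activeSpan p)ᗮ, inner ℝ (B.delta x) h = B.gap x := by
    rw [D_eq_minEnergy hp, minEnergy_eq_zero_iff (slice_nonempty x) hp]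
    simp only [mem_slice_iff, mem_orthogonal_activeSpan_iff]
    exact ⟨fun ⟨_, ⟨h, hh, hy⟩, h0⟩ => ⟨h, hy ▸ h0, hh⟩, fun ⟨h, h0, hh⟩ => ⟨_, ⟨h, hh, rfl⟩, h0⟩⟩
  rw [hiff]
  refine ⟨fun ⟨_, h0, hh⟩ hmem => (gap_pos x).ne' (hh ▸ h0 _ hmem), fun hmem => ?_⟩
  set u := (B.activeSpan p)ᗮ.starProjection (B.delta x) with hu
  have huS : u ∈ (B.activeSpan p)ᗮ := Submodule.starProjection_apply_mem _ _
  have hu0 : u ≠ 0 := fun h => hmem <| by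
    rwa [hu, Submodule.starProjection_apply_eq_zero_iff, Submodule.orthogonal_orthogonal] at h
  have hinner : inner ℝ (B.delta x) u ≠ 0 := by
    rw [← sub_add_cancel (B.delta x) u, inner_add_left, real_inner_self_eq_norm_sq, hu,
      Submodule.starProjection_inner_eq_zero _ _ huS, zero_add]
    exact pow_ne_zero 2 (norm_ne_zero_iff.2 hu0)
  exact ⟨(B.gap x / inner ℝ (B.delta x) u) • u, Submodule.smul_mem _ _ huS, by
    rw [inner_smul_right, div_mul_cancel₀ _ hinner]⟩

theorem fullSpan_le_of_delta_mem {S : Submodule ℝ (EuclideanSpace ℝ (Fin d))} {i : Fin K}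
    (hi : B.a i ∈ S) (h : ∀ x, B.delta x ∈ S) : B.fullSpan ≤ S := by
  have hbest : B.a B.best ∈ S := by
    by_cases hib : i = B.best
    · exact hib ▸ hi
    · simpa [delta] using add_mem (h ⟨i, hib⟩) hi
  refine fullSpan_le fun j => ?_
  by_cases hj : j = B.best
  · exact hj ▸ hbest
  · simpa [delta] using sub_mem hbest (h ⟨j, hj⟩)

theorem zeroInfo_eq_empty_iff (hp : p ∈ stdSimplex ℝ (Fin K)) :
    B.zeroInfo p = ∅ ↔ B.activeSpan p = B.fullSpan := by
  simp only [zeroInfo, eq_empty_iff_forall_notMem, mem_ofPred_eq, D_eq_zero_iff hp.1, not_not]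
  refine ⟨fun h => ?_, fun h x => h ▸ delta_mem_fullSpan x⟩
  obtain ⟨i, hi⟩ := exists_pos_of_mem_stdSimplex hp
  exact (activeSpan_le_fullSpan p).antisymm (fullSpan_le_of_delta_mem (a_mem_activeSpan hi) h)

theorem D_pos (hp : 0 ≤ p) (hS : B.activeSpan p = B.fullSpan) (x : B.Scenario) : 0 < B.D p x :=
  (D_nonneg hp x).lt_of_ne' fun h => (D_eq_zero_iff hp).1 h (hS ▸ delta_mem_fullSpan x)

end Span

section Gradient

variable {K d : ℕ} {B : LinearBandit K d} {p : Fin K → ℝ} {μ : B.Scenario → ℝ}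

theorem hasFDerivWithinAt_D (hp : 0 ≤ p) (hS : B.activeSpan p = B.fullSpan) {x : B.Scenario}
    {y : Fin K → ℝ} (hy : IsEnergyMinimizer (B.slice x) p y) :
    HasFDerivWithinAt (fun q => B.D q x) (dotCLM (y ^ 2)) (orthant K) p :=
  (hasFDerivWithinAt_minEnergy hp (fun _ => eq_zero_of_mem_direction_slice hp hS) hy).congr
    (fun _ hq => D_eq_minEnergy hq x) (D_eq_minEnergy hp x)

theorem mem_diffSet (hp : p ∈ stdSimplex ℝ (Fin K)) (hμ : μ ∈ stdSimplex ℝ B.Scenario)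
    (hS : B.activeSpan p = B.fullSpan) : (p, μ) ∈ B.diffSet := by
  refine ⟨hp, hμ, DifferentiableWithinAt.fun_sum fun x _ => ?_⟩
  obtain ⟨y, hy⟩ := exists_isRegularMinimizer (slice_nonempty x) hp.1
  have hD : DifferentiableWithinAt ℝ (fun q => B.D q x) (orthant K) p :=
    (hasFDerivWithinAt_D hp.1 hS hy.isEnergyMinimizer).differentiableWithinAt
  have hDfst : DifferentiableWithinAt ℝ (fun w : (Fin K → ℝ) × (B.Scenario → ℝ) => B.D w.1 x)
      (orthant K ×ˢ univ) (p, μ) :=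
    hD.comp (f := Prod.fst) (p, μ) differentiableWithinAt_fst fun w hw => hw.1
  have hμx : DifferentiableWithinAt ℝ (fun w : (Fin K → ℝ) × (B.Scenario → ℝ) => w.2 x)
      (orthant K ×ˢ univ) (p, μ) :=
    ((ContinuousLinearMap.proj (R := ℝ) (φ := fun _ : B.Scenario => ℝ) x).comp
      (ContinuousLinearMap.snd ℝ (Fin K → ℝ) (B.Scenario → ℝ))).differentiableAt
        |>.differentiableWithinAt
  exact hμx.fun_mul hDfst

theorem uniqueDiffOn_orthant : UniqueDiffOn ℝ (orthant K) := by
  have : orthant K = univ.pi fun _ => Ici (0 : ℝ) := by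
    ext
    simp only [orthant, mem_ofPred_eq, mem_univ_pi, mem_Ici]
  exact this ▸ UniqueDiffOn.univ_pi fun _ => uniqueDiffOn_Ici 0

theorem exists_isRegularMinimizer_gradP_eq (h : (p, μ) ∈ B.diffSet) :
    ∃ y, (∀ x, IsRegularMinimizer (B.slice x) p (y x)) ∧ B.gradP p μ = mixedGradient μ y := by
  obtain ⟨hp, hμ, hdiff⟩ := h
  have hF : DifferentiableWithinAt ℝ (fun q => B.F q μ) (orthant K) p :=
    hdiff.comp (g := fun w : (Fin K → ℝ) × (B.Scenario → ℝ) => B.F w.1 w.2)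
      (f := fun q => (q, μ)) p (by fun_prop) fun _ hq => ⟨hq, mem_univ _⟩
  obtain ⟨y, hy, hf⟩ := exists_isRegularMinimizer_eq_mixedGradient slice_nonempty hp.1 hμ.1
    (hF.hasFDerivWithinAt.congr (fun q hq => (F_eq_mixedEnergy hq μ).symm)
      (F_eq_mixedEnergy hp.1 μ).symm)
  refine ⟨y, hy, funext fun i => ?_⟩
  rw [gradP, hf, dotCLM_apply, single_one_dotProduct]

theorem clarkeP_subset : B.clarkeP p μ ⊆
    convexHull ℝ {f | ∃ y, (∀ x, IsRegularMinimizer (B.slice x) p (y x)) ∧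
      f = mixedGradient μ y} := by
  refine convexHull_mono ?_
  rintro f ⟨z, hz, hlim, hgrad⟩
  choose y hy hyf using fun n => exists_isRegularMinimizer_gradP_eq (hz n)
  obtain ⟨y₀, hy₀, φ, hφ, hylim⟩ := exists_subseq_tendsto_isRegularMinimizer
    ((continuous_fst.tendsto _).comp hlim) hy
  refine ⟨y₀, hy₀, tendsto_nhds_unique (hgrad.comp hφ.tendsto_atTop) ?_⟩
  have hμlim := ((continuous_snd.tendsto _).comp hlim).comp hφ.tendsto_atTop
  exact ((continuous_mixedGradient.tendsto (μ, y₀)).comp (hμlim.prodMk_nhds hylim)).congr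
    fun n => (hyf (φ n)).symm

theorem F_single (p : Fin K → ℝ) (x : B.Scenario) : B.F p (Pi.single x 1) = B.D p x :=
  single_one_dotProduct x (B.D p)

theorem exists_isRegularMinimizer_fderivWithin_D_eq (hp : 0 ≤ p) {x : B.Scenario}
    (h : DifferentiableWithinAt ℝ (fun q => B.D q x) (orthant K) p) :
    ∃ y, IsRegularMinimizer (B.slice x) p y ∧
      fderivWithin ℝ (fun q => B.D q x) (orthant K) p = dotCLM (y ^ 2) := by
  have hcongr : ∀ q, 0 ≤ q → mixedEnergy B.slice (Pi.single x 1) q = B.D q x := fun q hq => by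
    rw [← F_eq_mixedEnergy hq, F_single]
  obtain ⟨y, hy, hf⟩ := exists_isRegularMinimizer_eq_mixedGradient slice_nonempty hp
    (single_mem_stdSimplex ℝ x).1 (h.hasFDerivWithinAt.congr hcongr (hcongr p hp))
  refine ⟨y x, hy x, hf.trans ?_⟩
  rw [mixedGradient, Finset.sum_eq_single x, Pi.single_eq_same, one_smul]
  · exact fun z _ hz => by rw [Pi.single_eq_of_ne hz, zero_smul]
  · exact fun hx => (hx (Finset.mem_univ x)).elim

theorem exists_forall_norm_le_of_isRegularMinimizer (B : LinearBandit K d) :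
    ∃ R, ∀ x p y, IsRegularMinimizer (B.slice x) p y → ‖y‖ ≤ R := by
  choose R hR using fun x => exists_norm_le_of_isRegularMinimizer (B.slice x)
  obtain ⟨M, hM⟩ := (finite_range R).bddAbove
  exact ⟨M, fun x p y hy => (hR x p y hy).trans (hM (mem_range_self x))⟩

theorem exists_isGradientBound (B : LinearBandit K d) : ∃ M, B.IsGradientBound M := by
  obtain ⟨R, hR⟩ := B.exists_forall_norm_le_of_isRegularMinimizer
  refine ⟨R ^ 2, fun x p hp hdiff i => ?_⟩
  obtain ⟨y, hy, hf⟩ := exists_isRegularMinimizer_fderivWithin_D_eq hp.1 hdiff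
  rw [hf, dotCLM_apply, single_one_dotProduct, Pi.pow_apply, abs_sq, ← sq_abs]
  exact pow_le_pow_left₀ (abs_nonneg _) ((norm_le_pi_norm y i).trans (hR x p y hy)) 2

namespace IsGradientBound

variable {M : ℝ} {x : B.Scenario} {y : Fin K → ℝ}

theorem sq_le_of_isEnergyMinimizer (hM : B.IsGradientBound M) (hp : p ∈ stdSimplex ℝ (Fin K))
    (hpos : ∀ i, 0 < p i) (hy : IsEnergyMinimizer (B.slice x) p y) (i : Fin K) :
    y i ^ 2 ≤ M := by
  have hderiv := hasFDerivWithinAt_D hp.1 (activeSpan_of_pos hpos) hy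
  have hle := hM x p hp hderiv.differentiableWithinAt i
  rw [hderiv.fderivWithin (uniqueDiffOn_orthant p hp.1), dotCLM_apply,
    single_one_dotProduct] at hle
  exact (le_abs_self _).trans hle

theorem sq_le_of_isRegularMinimizer (hM : B.IsGradientBound M)
    (hy : IsRegularMinimizer (B.slice x) p y) (i : Fin K) : y i ^ 2 ≤ M :=
  hy.apply_sq_le fun _ hp hpos _ hy => hM.sq_le_of_isEnergyMinimizer hp hpos hy i

theorem pos (hM : B.IsGradientBound M) (x : B.Scenario) : 0 < M := by
  have : Nonempty (Fin K) := ⟨x⟩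
  obtain ⟨p, hp, hpos⟩ := exists_forall_pos_mem_stdSimplex (Fin K)
  obtain ⟨y, hy⟩ := exists_isRegularMinimizer (slice_nonempty x) hp.1
  have hD := D_pos hp.1 (activeSpan_of_pos hpos) x
  rw [D_eq_minEnergy hp.1, hy.isEnergyMinimizer.minEnergy_eq] at hD
  exact hD.trans_le <| (dotProduct_le_ciSup hp _).trans <|
    ciSup_le fun i => hM.sq_le_of_isRegularMinimizer hy i

end IsGradientBound

theorem gradMu_eq (p : Fin K → ℝ) (μ : B.Scenario → ℝ) : B.gradMu p μ = B.D p := by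
  have hF : (fun ν => B.F p ν) = dotCLM (B.D p) := by
    ext ν
    rw [dotCLM_apply]
    rfl
  ext x
  rw [gradMu, hF, ContinuousLinearMap.fderiv, dotCLM_apply, single_one_dotProduct]

end Gradient

section Constants

variable {K d : ℕ} {B : LinearBandit K d} {S : Submodule ℝ (EuclideanSpace ℝ (Fin d))}

theorem gapMin_le_gap (x : B.Scenario) : B.gapMin ≤ B.gap x := by
  rw [gap, delta, inner_sub_left]
  exact ciInf_le (finite_range _).bddBelow x

theorem gapMin_pos [Nonempty B.Scenario] : 0 < B.gapMin := by
  obtain ⟨z, hz⟩ := exists_eq_ciInf_of_finite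
    (f := fun x : B.Scenario => (inner ℝ (B.a B.best) B.θ - inner ℝ (B.a x) B.θ : ℝ))
  rw [gapMin, ← hz, sub_pos]
  exact B.best_unique z z.2

theorem nonempty_outside (hS : S < B.fullSpan) : Nonempty (B.Outside S) := by
  by_contra h
  exact hS.not_ge (fullSpan_le fun j => not_not.1 fun hj => h ⟨j, hj⟩)

theorem exists_norm_eq_one_mem (hS : S < B.fullSpan) : ∃ u ∈ Sᗮ ⊓ B.fullSpan, ‖u‖ = 1 := by
  have hne : Sᗮ ⊓ B.fullSpan ≠ ⊥ := fun h0 => hS.ne <| by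
    rw [← Submodule.sup_orthogonal_inf_of_hasOrthogonalProjection hS.le, h0, sup_bot_eq]
  obtain ⟨u, hu, hu0⟩ := Submodule.exists_mem_ne_zero_of_ne_bot hne
  exact ⟨(‖u‖)⁻¹ • u, Submodule.smul_mem _ _ hu, norm_smul_inv_norm hu0⟩

theorem eq_zero_of_mem_fullSpan {u : EuclideanSpace ℝ (Fin d)} (hu : u ∈ B.fullSpan)
    (h : B.response u = 0) : u = 0 := by
  have hle : B.fullSpan ≤ (ℝ ∙ u)ᗮ := fullSpan_le fun i =>
    Submodule.mem_orthogonal_singleton_iff_inner_left.2 <|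
      response_apply_eq_zero_iff.1 (congrFun h i)
  exact inner_self_eq_zero.1 (Submodule.mem_orthogonal_singleton_iff_inner_left.1 (hle hu))

theorem inner_sq_div_sq (h : EuclideanSpace ℝ (Fin d)) (j : Fin K) :
    inner ℝ (B.a j) h ^ 2 / (B.σ j : ℝ) ^ 2 = 2 * B.response h j ^ 2 := by
  have := coe_σ_pos (B := B) j
  rw [response_apply_sq]
  field_simp

theorem le_iSup_outside (u : EuclideanSpace ℝ (Fin d)) (j : B.Outside S) :
    2 * B.response u j ^ 2 ≤
      ⨆ j : B.Outside S, (inner ℝ (B.a j) u) ^ 2 / (B.σ j : ℝ) ^ 2 := by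
  rw [← inner_sq_div_sq]
  exact le_ciSup (f := fun j : B.Outside S => (inner ℝ (B.a j) u) ^ 2 / (B.σ j : ℝ) ^ 2)
    (finite_range _).bddAbove j

theorem exists_forall_mem_fullSpan_norm_le (B : LinearBandit K d) :
    ∃ C > 0, ∀ u ∈ B.fullSpan, ‖u‖ ≤ C * ‖B.response u‖ := by
  obtain ⟨C, hC, hanti⟩ := (B.response.domRestrict B.fullSpan).exists_antilipschitzWith <|
    LinearMap.ker_eq_bot'.2 fun u hu => Subtype.ext (eq_zero_of_mem_fullSpan u.2 hu)
  exact ⟨C, hC, fun u hu => by simpa using hanti.le_mul_norm_sub ⟨u, hu⟩ 0⟩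

theorem gam_pos (hS : S < B.fullSpan) : 0 < B.gam S := by
  obtain ⟨C, hC, hle⟩ := B.exists_forall_mem_fullSpan_norm_le
  obtain ⟨u₀, hu₀, hu₀1⟩ := exists_norm_eq_one_mem hS
  have : Nonempty {u : EuclideanSpace ℝ (Fin d) // u ∈ Sᗮ ⊓ B.fullSpan ∧ ‖u‖ = 1} :=
    ⟨⟨u₀, hu₀, hu₀1⟩⟩
  refine (show 0 < 2 * (C⁻¹ / 2) ^ 2 by positivity).trans_le (le_ciInf fun ⟨u, hu, hu1⟩ => ?_)
  have hnorm : C⁻¹ / 2 < ‖B.response u‖ := by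
    have := hle u hu.2
    rw [hu1, ← inv_le_iff_one_le_mul₀' hC] at this
    exact (half_lt_self (inv_pos.2 hC)).trans_le this
  obtain ⟨j, hj⟩ : ∃ j, C⁻¹ / 2 ≤ ‖B.response u j‖ := by
    by_contra! h
    exact hnorm.not_ge ((pi_norm_le_iff_of_nonneg (by positivity)).2 fun j => (h j).le)
  have hjS : B.a j ∉ S := fun hmem => by
    rw [response_apply_eq_zero_iff.2 (hu.1 _ hmem), norm_zero] at hj
    exact hj.not_gt (by positivity)
  refine le_trans ?_ (le_iSup_outside u ⟨j, hjS⟩)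
  rw [Real.norm_eq_abs] at hj
  rw [← sq_abs (B.response u j)]
  gcongr

theorem exists_gam_mul_norm_sq_le (hS : S < B.fullSpan) {k : EuclideanSpace ℝ (Fin d)}
    (hk : k ∈ Sᗮ ⊓ B.fullSpan) (hk0 : k ≠ 0) :
    ∃ j, B.a j ∉ S ∧ B.gam S * ‖k‖ ^ 2 ≤ 2 * B.response k j ^ 2 := by
  have := nonempty_outside hS
  have hgam : B.gam S ≤
      ⨆ j : B.Outside S, (inner ℝ (B.a j) (‖k‖⁻¹ • k)) ^ 2 / (B.σ j : ℝ) ^ 2 :=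
    ciInf_le (f := fun u : {u : EuclideanSpace ℝ (Fin d) // u ∈ Sᗮ ⊓ B.fullSpan ∧ ‖u‖ = 1} =>
      ⨆ j : B.Outside S, (inner ℝ (B.a j) (u : EuclideanSpace ℝ (Fin d))) ^ 2 / (B.σ j : ℝ) ^ 2)
      ⟨0, forall_mem_range.2 fun _ => Real.iSup_nonneg fun _ => by positivity⟩
      ⟨‖k‖⁻¹ • k, Submodule.smul_mem _ _ hk, norm_smul_inv_norm hk0⟩
  obtain ⟨j, hj⟩ := exists_eq_ciSup_of_finite (f := fun j : B.Outside S =>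
    (inner ℝ (B.a j) (‖k‖⁻¹ • k)) ^ 2 / (B.σ j : ℝ) ^ 2)
  refine ⟨j, j.2, ?_⟩
  have hk0' : 0 < ‖k‖ := norm_pos_iff.2 hk0
  rwa [← hj, inner_sq_div_sq, map_smul, Pi.smul_apply, smul_eq_mul, mul_pow, inv_pow,
    mul_left_comm, ← div_eq_inv_mul, le_div_iff₀ (by positivity)] at hgam

theorem norm_starProjection_sq_le_rho (x : B.Scenario) :
    ‖Sᗮ.starProjection (B.delta x)‖ ^ 2 ≤ B.rho S :=
  le_ciSup (f := fun x => ‖Sᗮ.starProjection (B.delta x)‖ ^ 2) (finite_range _).bddAbove x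

theorem rho_pos {x : B.Scenario} (hx : B.delta x ∉ S) : 0 < B.rho S := by
  refine (sq_pos_of_pos (norm_pos_iff.2 fun h => hx ?_)).trans_le
    (norm_starProjection_sq_le_rho x)
  rwa [Submodule.starProjection_apply_eq_zero_iff, Submodule.orthogonal_orthogonal] at h

theorem gapMin_sq_le_rho_mul {x : B.Scenario} {k : EuclideanSpace ℝ (Fin d)} (hk : k ∈ Sᗮ)
    (hgap : inner ℝ (B.delta x) k = B.gap x) : B.gapMin ^ 2 ≤ B.rho S * ‖k‖ ^ 2 := by
  have : Nonempty B.Scenario := ⟨x⟩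
  have hinner : inner ℝ (Sᗮ.starProjection (B.delta x)) k = B.gap x := by
    rw [← hgap, eq_comm, ← sub_eq_zero, ← inner_sub_left]
    exact Submodule.starProjection_inner_eq_zero _ _ hk
  calc B.gapMin ^ 2
      ≤ (‖Sᗮ.starProjection (B.delta x)‖ * ‖k‖) ^ 2 :=
        pow_le_pow_left₀ gapMin_pos.le
          ((gapMin_le_gap x).trans (hinner ▸ real_inner_le_norm _ _)) 2
    _ = ‖Sᗮ.starProjection (B.delta x)‖ ^ 2 * ‖k‖ ^ 2 := mul_pow _ _ _
    _ ≤ B.rho S * ‖k‖ ^ 2 := by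
        gcongr
        exact norm_starProjection_sq_le_rho x

theorem exists_mem_orthogonal_inf_fullSpan (hS : S ≤ B.fullSpan) {h : EuclideanSpace ℝ (Fin d)}
    (hh : h ∈ Sᗮ) :
    ∃ k ∈ Sᗮ ⊓ B.fullSpan, ∀ v ∈ B.fullSpan, inner ℝ v k = inner ℝ v h := by
  have hinner : ∀ v ∈ B.fullSpan, inner ℝ v (B.fullSpan.starProjection h) = inner ℝ v h :=
    fun v hv => by
      rw [eq_comm, ← sub_eq_zero, ← inner_sub_right, real_inner_comm]
      exact Submodule.starProjection_inner_eq_zero _ _ hv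
  exact ⟨_, ⟨fun v hv => (hinner v (hS hv)).trans (hh v hv),
    Submodule.starProjection_apply_mem _ _⟩, hinner⟩

theorem exists_mconst_le_response_sq (hS : S < B.fullSpan) {x : B.Scenario}
    (hx : B.delta x ∉ S) {h : EuclideanSpace ℝ (Fin d)} (hh : h ∈ Sᗮ)
    (hgap : inner ℝ (B.delta x) h = B.gap x) :
    ∃ j, B.a j ∉ S ∧ B.mconst S ≤ B.response h j ^ 2 := by
  obtain ⟨k, hk, hinner⟩ := exists_mem_orthogonal_inf_fullSpan hS.le hh
  rw [← hinner _ (delta_mem_fullSpan x)] at hgap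
  have hk0 : k ≠ 0 := by
    rintro rfl
    exact (gap_pos x).ne (by rw [← hgap, inner_zero_right])
  obtain ⟨j, hjS, hj⟩ := exists_gam_mul_norm_sq_le hS hk hk0
  refine ⟨j, hjS, ?_⟩
  have hres : B.response h j = B.response k j := by
    rw [response_apply, response_apply, hinner _ (a_mem_fullSpan j)]
  have hsq : B.gapMin ^ 2 / B.rho S ≤ ‖k‖ ^ 2 :=
    (div_le_iff₀' (rho_pos hx)).2 (gapMin_sq_le_rho_mul hk.1 hgap)
  calc B.mconst S
      = B.gam S * (B.gapMin ^ 2 / B.rho S) / 2 := by rw [mconst]; ring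
    _ ≤ B.gam S * ‖k‖ ^ 2 / 2 := by
        have := (gam_pos hS).le
        gcongr
    _ ≤ B.response h j ^ 2 := by rw [hres]; linarith

theorem mconst_pos (hS : S < B.fullSpan) {x : B.Scenario} (hx : B.delta x ∉ S) :
    0 < B.mconst S := by
  have : Nonempty B.Scenario := ⟨x⟩
  exact mul_pos (div_pos (pow_pos gapMin_pos 2) two_pos) (div_pos (gam_pos hS) (rho_pos hx))

theorem card_outside_pos (hS : S < B.fullSpan) : (0 : ℝ) < Nat.card (B.Outside S) := by
  have := nonempty_outside hS
  exact_mod_cast Nat.card_pos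

theorem epsS_pos {M : ℝ} (hM : B.IsGradientBound M) (hS : S < B.fullSpan) {x : B.Scenario}
    (hx : B.delta x ∉ S) : 0 < B.epsS M S :=
  lt_min (by norm_num) <| div_pos (mconst_pos hS hx) <|
    mul_pos (mul_pos four_pos (card_outside_pos hS)) (hM.pos x)

theorem epsS_mul_le {M : ℝ} (hM : B.IsGradientBound M) (hS : S < B.fullSpan) (x : B.Scenario) :
    B.epsS M S * M ≤ B.mconst S / (4 * (Nat.card (B.Outside S) : ℝ)) := by
  have hcard := card_outside_pos hS
  have hMpos := hM.pos x
  calc B.epsS M S * M ≤ B.mconst S / (4 * (Nat.card (B.Outside S) : ℝ) * M) * M := by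
        gcongr
        exact min_le_right _ _
    _ = B.mconst S / (4 * (Nat.card (B.Outside S) : ℝ)) := by field_simp

end Constants

section Oracle

variable {K d : ℕ} {B : LinearBandit K d} {p q : Fin K → ℝ} {μ ν : B.Scenario → ℝ} {M : ℝ}
  {x : B.Scenario} {y : B.Scenario → Fin K → ℝ}

theorem isMinOn_of_mem_LMOmu (hν : ν ∈ B.LMOmu p μ) :
    IsMinOn (· ⬝ᵥ B.D p) (stdSimplex ℝ B.Scenario) ν :=
  fun ν' hν' => gradMu_eq p μ ▸ hν.2 ν' hν'

theorem eq_zero_of_mem_LMOmu (hp : 0 ≤ p) (hν : ν ∈ B.LMOmu p μ) {z : B.Scenario}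
    (hz : B.D p z = 0) (hx : B.D p x ≠ 0) : ν x = 0 := by
  refine eq_zero_of_isMaxOn_dotProduct (f := -B.D p) (j := z) hν.1 ?_ ?_
  · simpa only [dotProduct_neg] using (isMinOn_of_mem_LMOmu hν).neg
  · rw [Pi.neg_apply, Pi.neg_apply, hz, neg_lt_neg_iff]
    exact (D_nonneg hp x).lt_of_ne' hx

theorem LMOp_subset_stdSimplex (p : Fin K → ℝ) (μ : B.Scenario → ℝ) :
    B.LMOp p μ ⊆ stdSimplex ℝ (Fin K) :=
  convexHull_min (fun _ h => h.1) (convex_stdSimplex ℝ _)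

theorem clarkeP_subset_singleton (hp : 0 ≤ p) (hS : B.activeSpan p = B.fullSpan)
    (hy : ∀ x, IsRegularMinimizer (B.slice x) p (y x)) :
    B.clarkeP p μ ⊆ {mixedGradient μ y} := by
  refine clarkeP_subset.trans (convexHull_min ?_ (convex_singleton _))
  rintro _ ⟨z, hz, rfl⟩
  have hzy : z = y := funext fun x => (hy x).isEnergyMinimizer.eq_of_coercive
    (hz x).isEnergyMinimizer fun _ => eq_zero_of_mem_direction_slice hp hS
  rw [hzy, mem_singleton_iff]

theorem isMaxOn_of_mem_LMOp (hp : 0 ≤ p) (hS : B.activeSpan p = B.fullSpan)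
    (hy : ∀ x, IsRegularMinimizer (B.slice x) p (y x)) (hq : q ∈ B.LMOp p μ) :
    IsMaxOn (· ⬝ᵥ mixedGradient μ y) (stdSimplex ℝ (Fin K)) q := by
  have : Nonempty (Fin K) := ⟨B.best⟩
  have hsub : B.LMOp p μ ⊆ {r | ⨆ i, mixedGradient μ y i ≤ r ⬝ᵥ mixedGradient μ y} := by
    refine convexHull_min ?_ (convex_halfSpace_ge
      (.mk (fun _ _ => add_dotProduct _ _ _) fun _ _ => smul_dotProduct _ _ _) _)
    rintro r ⟨hr, f, hf, hmax⟩
    obtain rfl := mem_singleton_iff.1 (clarkeP_subset_singleton hp hS hy hf)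
    exact (dotProduct_eq_ciSup hr hmax).ge
  exact fun r hr => (dotProduct_le_ciSup hr _).trans (hsub hq)

theorem exists_response_eq_of_D_eq_zero (hp : 0 ≤ p) (hx : B.D p x = 0) {z : Fin K → ℝ}
    (hz : IsEnergyMinimizer (B.slice x) p z) :
    ∃ h ∈ (B.activeSpan p)ᗮ, inner ℝ (B.delta x) h = B.gap x ∧ B.response h = z := by
  obtain ⟨h, hgap, rfl⟩ := mem_slice_iff.1 hz.1
  rw [D_eq_minEnergy hp, hz.minEnergy_eq, dotProduct_sq_eq_zero_iff hp] at hx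
  exact ⟨h, mem_orthogonal_activeSpan_iff.2 hx, hgap, rfl⟩

theorem mixedGradient_le_of_mem_activeSpan (hp : 0 ≤ p) (hμ : 0 ≤ μ) (hM : B.IsGradientBound M)
    (hy : ∀ x, IsRegularMinimizer (B.slice x) p (y x)) {i : Fin K}
    (hi : B.a i ∈ B.activeSpan p) :
    mixedGradient μ y i ≤ (∑ x with B.D p x ≠ 0, μ x) * M := by
  rw [mixedGradient, Finset.sum_apply, Finset.sum_mul, Finset.sum_filter]
  refine Finset.sum_le_sum fun x _ => ?_
  rw [Pi.smul_apply, Pi.pow_apply, smul_eq_mul]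
  split_ifs with hx
  · exact mul_le_mul_of_nonneg_left (hM.sq_le_of_isRegularMinimizer (hy x) i) (hμ x)
  · obtain ⟨h, hh, -, hres⟩ :=
      exists_response_eq_of_D_eq_zero hp (not_not.1 hx) (hy x).isEnergyMinimizer
    rw [← hres, response_apply_eq_zero_iff.2 (hh _ hi), zero_pow two_ne_zero, mul_zero]

open scoped Classical in
theorem mconst_mul_le_sum_mixedGradient (hp : 0 ≤ p) (hμ : 0 ≤ μ)
    (hS : B.activeSpan p < B.fullSpan) (hy : ∀ x, IsEnergyMinimizer (B.slice x) p (y x)) :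
    (∑ x with B.D p x = 0, μ x) * B.mconst (B.activeSpan p) ≤
      ∑ j with B.a j ∉ B.activeSpan p, mixedGradient μ y j := by
  simp only [mixedGradient, Finset.sum_apply, Pi.smul_apply, Pi.pow_apply, smul_eq_mul]
  rw [Finset.sum_comm, Finset.sum_mul, Finset.sum_filter]
  simp only [← Finset.mul_sum]
  refine Finset.sum_le_sum fun x _ => ?_
  split_ifs with hx
  · obtain ⟨h, hh, hgap, hres⟩ := exists_response_eq_of_D_eq_zero hp hx (hy x)
    obtain ⟨j, hj, hle⟩ := exists_mconst_le_response_sq hS ((D_eq_zero_iff hp).1 hx) hh hgap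
    refine mul_le_mul_of_nonneg_left ((hres ▸ hle).trans ?_) (hμ x)
    exact Finset.single_le_sum (f := fun j => y x j ^ 2) (fun _ _ => sq_nonneg _)
      (Finset.mem_filter.2 ⟨Finset.mem_univ j, hj⟩)
  · exact mul_nonneg (hμ x) (Finset.sum_nonneg fun _ _ => sq_nonneg _)

theorem le_of_mem_clarkeP (hp : 0 ≤ p) (hμ : 0 ≤ μ) (hM : B.IsGradientBound M)
    {f : Fin K → ℝ} (hf : f ∈ B.clarkeP p μ) {i : Fin K} (hi : B.a i ∈ B.activeSpan p) :
    f i ≤ (∑ x with B.D p x ≠ 0, μ x) * M := by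
  refine convexHull_min ?_ (convex_halfSpace_le
    (LinearMap.proj (R := ℝ) (φ := fun _ : Fin K => ℝ) i).isLinear _) (clarkeP_subset hf)
  rintro _ ⟨y, hy, rfl⟩
  exact mixedGradient_le_of_mem_activeSpan hp hμ hM hy hi

open scoped Classical in
theorem mconst_mul_le_sum_of_mem_clarkeP (hp : 0 ≤ p) (hμ : 0 ≤ μ)
    (hS : B.activeSpan p < B.fullSpan) {f : Fin K → ℝ} (hf : f ∈ B.clarkeP p μ) :
    (∑ x with B.D p x = 0, μ x) * B.mconst (B.activeSpan p) ≤
      ∑ j with B.a j ∉ B.activeSpan p, f j := by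
  refine convexHull_min (t := {g | _ ≤ ∑ j with B.a j ∉ B.activeSpan p, g j}) ?_
    (convex_halfSpace_ge (.mk (fun _ _ => Finset.sum_add_distrib)
      fun _ _ => (Finset.mul_sum _ _ _).symm) _) (clarkeP_subset hf)
  rintro _ ⟨y, hy, rfl⟩
  exact mconst_mul_le_sum_mixedGradient hp hμ hS fun x => (hy x).isEnergyMinimizer

theorem exists_D_eq_zero (hp : p ∈ stdSimplex ℝ (Fin K)) (hS : B.activeSpan p ≠ B.fullSpan) :
    ∃ x, B.D p x = 0 :=
  nonempty_iff_ne_empty.2 (mt (zeroInfo_eq_empty_iff hp).1 hS)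

theorem exists_forall_lt_of_mem_clarkeP (hp : p ∈ stdSimplex ℝ (Fin K))
    (hμ : μ ∈ stdSimplex ℝ B.Scenario) (hM : B.IsGradientBound M)
    (hS : B.activeSpan p < B.fullSpan)
    (hε : ∑ x with B.D p x ≠ 0, μ x ≤ B.epsS M (B.activeSpan p))
    {f : Fin K → ℝ} (hf : f ∈ B.clarkeP p μ) :
    ∃ j, ∀ i, B.a i ∈ B.activeSpan p → f i < f j := by
  classical
  obtain ⟨x, hx⟩ := exists_D_eq_zero hp hS.ne
  set ε := B.epsS M (B.activeSpan p)
  set m := B.mconst (B.activeSpan p)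
  have hm : 0 < m := mconst_pos hS ((D_eq_zero_iff hp.1).1 hx)
  have hcard := card_outside_pos hS
  have hinside : ∀ i, B.a i ∈ B.activeSpan p → f i ≤ ε * M := fun i hi =>
    (le_of_mem_clarkeP hp.1 hμ.1 hM hf hi).trans
      (mul_le_mul_of_nonneg_right hε (hM.pos x).le)
  have hhalf : 1 / 2 ≤ ∑ x with B.D p x = 0, μ x := by
    have hsum := Finset.sum_filter_add_sum_filter_not Finset.univ (fun x => B.D p x = 0) μ
    have hε2 : ε ≤ 1 / 2 := min_le_left _ _
    rw [hμ.2] at hsum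
    linarith
  suffices ∃ j, ε * M < f j from this.imp fun j hj i hi => (hinside i hi).trans_lt hj
  by_contra! hcon
  have : 1 / 2 * m ≤ m / 4 := calc
    1 / 2 * m ≤ (∑ x with B.D p x = 0, μ x) * m := by gcongr
    _ ≤ ∑ j with B.a j ∉ B.activeSpan p, f j := mconst_mul_le_sum_of_mem_clarkeP hp.1 hμ.1 hS hf
    _ ≤ Nat.card (B.Outside (B.activeSpan p)) * (ε * M) := by
        rw [Nat.card_eq_fintype_card, Fintype.card_subtype, ← nsmul_eq_mul]
        exact Finset.sum_le_card_nsmul _ _ _ fun j _ => hcon j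
    _ ≤ Nat.card (B.Outside (B.activeSpan p)) *
          (m / (4 * (Nat.card (B.Outside (B.activeSpan p)) : ℝ))) := by
        gcongr
        exact epsS_mul_le hM hS x
    _ = m / 4 := by field_simp
  linarith

theorem exists_pos_outside_of_mem_LMOp (hp : p ∈ stdSimplex ℝ (Fin K))
    (hμ : μ ∈ stdSimplex ℝ B.Scenario) (hM : B.IsGradientBound M)
    (hS : B.activeSpan p < B.fullSpan)
    (hε : ∑ x with B.D p x ≠ 0, μ x ≤ B.epsS M (B.activeSpan p)) (hq : q ∈ B.LMOp p μ) :
    ∃ j, B.a j ∉ B.activeSpan p ∧ 0 < q j := by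
  have hsub : B.LMOp p μ ⊆ {r | ∀ i, B.a i ∈ B.activeSpan p → r i = 0} := by
    refine convexHull_min ?_ fun r hr s hs a b _ _ _ i hi => by simp [hr i hi, hs i hi]
    rintro r ⟨hr, f, hf, hmax⟩ i hi
    obtain ⟨j, hj⟩ := exists_forall_lt_of_mem_clarkeP hp hμ hM hS hε hf
    exact eq_zero_of_isMaxOn_dotProduct hr hmax (hj i hi)
  obtain ⟨j, hj⟩ := exists_pos_of_mem_stdSimplex (LMOp_subset_stdSimplex p μ hq)
  exact ⟨j, fun hmem => hj.ne' (hsub hq j hmem), hj⟩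

end Oracle

section Solution

variable {K d : ℕ} {B : LinearBandit K d} {M : ℝ} {S : Submodule ℝ (EuclideanSpace ℝ (Fin d))}
  {x : B.Scenario}

theorem timeS_nonneg (hM : B.IsGradientBound M) (hS : S < B.fullSpan) (hx : B.delta x ∉ S) :
    0 ≤ B.timeS M S := by
  have hle : B.epsS M S ≤ 1 / 2 := min_le_left _ _
  exact Real.log_nonneg ((one_le_div (epsS_pos hM hS hx)).2 (by linarith))

theorem exp_neg_timeS (hM : B.IsGradientBound M) (hS : S < B.fullSpan) (hx : B.delta x ∉ S) :
    Real.exp (-B.timeS M S) = B.epsS M S := by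
  rw [timeS, one_div, Real.log_inv, neg_neg, Real.exp_log (epsS_pos hM hS hx)]

theorem exists_delta_notMem {p : Fin K → ℝ} (hp : p ∈ stdSimplex ℝ (Fin K))
    (hS : B.activeSpan p < B.fullSpan) : ∃ x, B.delta x ∉ B.activeSpan p :=
  (exists_D_eq_zero hp hS.ne).imp fun _ => (D_eq_zero_iff hp.1).1

namespace IsSolution

variable {p : ℝ → Fin K → ℝ} {μ : ℝ → B.Scenario → ℝ} {s t : ℝ}

theorem absolutelyContinuousOnInterval (h : B.IsSolution p μ) (hs : 0 ≤ s) (hst : s ≤ t) :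
    AbsolutelyContinuousOnInterval p s t ∧ AbsolutelyContinuousOnInterval μ s t := by
  have hsub : uIcc s t ⊆ uIcc 0 (t + 1) := by
    rw [uIcc_of_le hst, uIcc_of_le (by linarith)]
    exact Icc_subset_Icc hs (by linarith)
  exact ⟨(h.ac_p (t + 1) (by linarith)).mono hsub, (h.ac_mu (t + 1) (by linarith)).mono hsub⟩

theorem ae_hasDerivAt (h : B.IsSolution p μ) :
    ∀ᵐ t, 0 < t → ∃ q ∈ B.LMOp (p t) (μ t), ∃ ν ∈ B.LMOmu (p t) (μ t),
      HasDerivAt p (q - p t) t ∧ HasDerivAt μ (ν - μ t) t :=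
  (ae_restrict_iff' measurableSet_Ioi).1 h.inclusion

theorem pos_of_le (h : B.IsSolution p μ) (hs : 0 ≤ s) (hst : s ≤ t) {i : Fin K}
    (hi : 0 < p s i) : 0 < p t i := by
  have hexp : Real.exp s * p s i ≤ Real.exp t * p t i := by
    refine exp_mul_apply_le_exp_mul_apply hst (h.absolutelyContinuousOnInterval hs hst).1 ?_ i
    filter_upwards [h.ae_hasDerivAt] with r hr hmem
    obtain ⟨q, hq, -, -, hd, -⟩ := hr (hs.trans_lt hmem.1)
    exact ⟨q, (LMOp_subset_stdSimplex _ _ hq).1, hd⟩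
  exact pos_of_mul_pos_right ((mul_pos (Real.exp_pos s) hi).trans_le hexp) (Real.exp_pos t).le

theorem activeSpan_le (h : B.IsSolution p μ) (hs : 0 ≤ s) (hst : s ≤ t) :
    B.activeSpan (p s) ≤ B.activeSpan (p t) :=
  activeSpan_mono fun _ => h.pos_of_le hs hst

theorem exp_mul_mu_le (h : B.IsSolution p μ) (hs : 0 ≤ s) (hst : s ≤ t)
    (hS : S < B.fullSpan) (hconst : ∀ r ∈ Ioo s t, B.activeSpan (p r) = S)
    (hx : B.delta x ∈ S) : Real.exp t * μ t x ≤ Real.exp s * μ s x := by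
  suffices Real.exp s * -μ s x ≤ Real.exp t * -μ t x by linarith
  refine exp_mul_le_exp_mul hst
    (absolutelyContinuousOnInterval_apply (h.absolutelyContinuousOnInterval hs hst).2 x).fun_neg ?_
  filter_upwards [h.ae_hasDerivAt] with r hr hmem
  have hr0 : 0 < r := hs.trans_lt hmem.1
  obtain ⟨-, -, ν, hν, -, hd⟩ := hr hr0
  obtain ⟨z, hz⟩ := exists_D_eq_zero (h.mem_p r hr0.le) ((hconst r hmem).trans_ne hS.ne)
  have hDx : B.D (p r) x ≠ 0 := by
    rwa [Ne, D_eq_zero_iff (h.mem_p r hr0.le).1, hconst r hmem, not_not]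
  have hνx := eq_zero_of_mem_LMOmu (h.mem_p r hr0.le).1 hν hz hDx
  refine ⟨0, le_rfl, ?_⟩
  have hneg := (hasDerivAt_pi.1 hd x).fun_neg
  rw [Pi.sub_apply, hνx, zero_sub] at hneg
  rwa [zero_sub]

theorem sum_mu_le (h : B.IsSolution p μ) (hs : 0 ≤ s) (hS : S < B.fullSpan)
    (hconst : ∀ r ∈ Ioo s t, B.activeSpan (p r) = S) {r : ℝ} (hr : r ∈ Ioo s t) :
    ∑ x with B.D (p r) x ≠ 0, μ r x ≤ Real.exp (s - r) := by
  have hle : ∀ x, B.D (p r) x ≠ 0 → μ r x ≤ Real.exp (s - r) * μ s x := by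
    intro x hx
    rw [Ne, D_eq_zero_iff (h.mem_p r (hs.trans hr.1.le)).1, hconst r hr, not_not] at hx
    rw [Real.exp_sub, div_mul_eq_mul_div, le_div_iff₀' (Real.exp_pos r)]
    exact h.exp_mul_mu_le hs hr.1.le hS (fun w hw => hconst w ⟨hw.1, hw.2.trans hr.2⟩) hx
  calc ∑ x with B.D (p r) x ≠ 0, μ r x
      ≤ ∑ x with B.D (p r) x ≠ 0, Real.exp (s - r) * μ s x :=
        Finset.sum_le_sum fun x hx => hle x (Finset.mem_filter.1 hx).2
    _ ≤ ∑ x, Real.exp (s - r) * μ s x :=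
        Finset.sum_le_univ_sum_of_nonneg fun x =>
          mul_nonneg (Real.exp_pos _).le ((h.mem_mu s hs).1 x)
    _ = Real.exp (s - r) := by rw [← Finset.mul_sum, (h.mem_mu s hs).2, mul_one]

theorem sub_le_timeS (h : B.IsSolution p μ) (hM : B.IsGradientBound M) (hS : S < B.fullSpan)
    (hx : B.delta x ∉ S) (hs : 0 ≤ s) (hconst : ∀ r ∈ Ioo s t, B.activeSpan (p r) = S) :
    t - s ≤ B.timeS M S := by
  by_contra! hlt
  obtain ⟨r, hr, hincl⟩ := exists_mem_Ioo_of_ae h.ae_hasDerivAt (lt_sub_iff_add_lt'.1 hlt)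
  have hrs : r ∈ Ioo s t := ⟨by linarith [hr.1, timeS_nonneg hM hS hx], hr.2⟩
  have hr0 : 0 < r := hs.trans_lt hrs.1
  obtain ⟨q, hq, -, -, hd, -⟩ := hincl hr0
  have hsmall : ∑ x with B.D (p r) x ≠ 0, μ r x ≤ B.epsS M S :=
    (h.sum_mu_le hs hS hconst hrs).trans <| exp_neg_timeS hM hS hx ▸
      Real.exp_le_exp.2 (by linarith [hr.1])
  obtain ⟨j, hj, hqj⟩ : ∃ j, B.a j ∉ S ∧ 0 < q j := by
    rw [← hconst r hrs] at hS hsmall ⊢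
    exact exists_pos_outside_of_mem_LMOp (h.mem_p r hr0.le) (h.mem_mu r hr0.le) hM hS hsmall hq
  have hzero : ∀ w ∈ Ioo s t, p w j = 0 := fun w hw => not_not.1 fun hne =>
    hj <| hconst w hw ▸ a_mem_activeSpan
      (((h.mem_p w (hs.trans hw.1.le)).1 j).lt_of_ne' hne)
  have hderiv : (q - p r) j = 0 := (hasDerivAt_pi.1 hd j).unique <|
    (hasDerivAt_const r (0 : ℝ)).congr_of_eventuallyEq <|
      eventually_of_mem (Ioo_mem_nhds hrs.1 hrs.2) hzero
  rw [Pi.sub_apply, hzero r hrs, sub_zero] at hderiv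
  exact hqj.ne' hderiv

theorem exists_activeSpan_eq_left (h : B.IsSolution p μ) (ht : 0 < t) :
    ∃ s ∈ Ico 0 t, B.activeSpan (p s) = B.activeSpan (p t) := by
  have hcont : ContinuousWithinAt p (Ioo 0 t) t :=
    ((h.ac_p t ht).continuousOn t right_mem_uIcc).mono <| by
      rw [uIcc_of_le ht.le]
      exact Ioo_subset_Icc_self
  have hev : ∀ᶠ s in 𝓝[Ioo 0 t] t, ∀ i, 0 < p t i → 0 < p s i := by
    refine eventually_all.2 fun i => ?_
    by_cases hi : 0 < p t i
    · exact ((tendsto_pi_nhds.1 hcont i).eventually (lt_mem_nhds hi)).mono fun _ hs _ => hs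
    · exact Eventually.of_forall fun _ hi' => absurd hi' hi
  have := right_nhdsWithin_Ioo_neBot ht
  obtain ⟨s, hs, hmem⟩ := (hev.and self_mem_nhdsWithin).exists
  exact ⟨s, ⟨hmem.1.le, hmem.2⟩,
    le_antisymm (h.activeSpan_le hmem.1.le hmem.2.le) (activeSpan_mono hs)⟩

theorem exists_activeSpan_eq_fullSpan (h : B.IsSolution p μ) :
    ∃ T, 0 ≤ T ∧ B.activeSpan (p T) = B.fullSpan := by
  obtain ⟨M, hM⟩ := B.exists_isGradientBound
  obtain ⟨_, ⟨s, hs, rfl⟩, hmax⟩ := WellFounded.has_min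
    (wellFounded_gt (α := Submodule ℝ (EuclideanSpace ℝ (Fin d))))
    ((fun t => B.activeSpan (p t)) '' Ici 0) ⟨_, 0, mem_Ici.2 le_rfl, rfl⟩
  rw [mem_Ici] at hs
  refine ⟨s, hs, by_contra fun hne => ?_⟩
  have hS := (activeSpan_le_fullSpan (p s)).lt_of_ne hne
  obtain ⟨x, hx⟩ := exists_delta_notMem (h.mem_p s hs) hS
  have hconst : ∀ r, s ≤ r → B.activeSpan (p r) = B.activeSpan (p s) := fun r hr =>
    ((h.activeSpan_le hs hr).eq_of_not_lt (hmax _ ⟨r, hs.trans hr, rfl⟩)).symm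
  have := h.sub_le_timeS hM hS hx (t := s + B.timeS M (B.activeSpan (p s)) + 1) hs
    fun r hr => hconst r hr.1.le
  linarith

end IsSolution

end Solution

section Epochs

variable {K d : ℕ} {B : LinearBandit K d}

theorem finrank_fullSpan_le {p : Fin K → ℝ} (hp : p ∈ stdSimplex ℝ (Fin K)) :
    Module.finrank ℝ B.fullSpan ≤ Module.finrank ℝ (B.activeSpan p) +
      Module.finrank ℝ (Submodule.span ℝ (range B.delta)) := by
  obtain ⟨i, hi⟩ := exists_pos_of_mem_stdSimplex hp
  have hle : B.fullSpan ≤ B.activeSpan p ⊔ Submodule.span ℝ (range B.delta) :=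
    fullSpan_le_of_delta_mem (Submodule.mem_sup_left (a_mem_activeSpan hi)) fun x =>
      Submodule.mem_sup_right (Submodule.subset_span (mem_range_self x))
  exact (Submodule.finrank_mono hle).trans (Submodule.finrank_add_le_finrank_add_finrank _ _)

theorem finrank_span_delta_le (B : LinearBandit K d) :
    Module.finrank ℝ (Submodule.span ℝ (range B.delta)) ≤ Module.finrank ℝ B.fullSpan :=
  Submodule.finrank_mono <| Submodule.span_le.2 <| range_subset_iff.2 delta_mem_fullSpan

variable {M : ℝ} {p : ℝ → Fin K → ℝ} {μ : ℝ → B.Scenario → ℝ} {r : ℕ}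
  {S : ℕ → Submodule ℝ (EuclideanSpace ℝ (Fin d))} {τ : ℕ → ℝ}

namespace IsSolution

theorem exists_isStaircase (h : B.IsSolution p μ) :
    ∃ r S τ, IsStaircase (fun t => B.activeSpan (p t)) B.fullSpan r S τ := by
  obtain ⟨T, hT, hfull⟩ := h.exists_activeSpan_eq_fullSpan
  rw [← hfull]
  exact _root_.exists_isStaircase (fun s hs _ _ hst => h.activeSpan_le hs hst)
    (fun t ht => h.exists_activeSpan_eq_left ht) hT
    fun t _ => hfull ▸ activeSpan_le_fullSpan (p t)

theorem epoch_count_le (h : B.IsSolution p μ)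
    (hτ : IsStaircase (fun t => B.activeSpan (p t)) B.fullSpan r S τ) :
    r ≤ Module.finrank ℝ (Submodule.span ℝ (range B.delta)) := by
  have hstep : ∀ l ≤ r, Module.finrank ℝ (S 0) + l ≤ Module.finrank ℝ (S l) := by
    intro l
    induction l with
    | zero => exact fun _ => le_rfl
    | succ l ih =>
      intro hl
      exact (ih (by lia)).trans_lt (Submodule.finrank_lt_finrank_of_lt (hτ.value_lt l hl))
  have hlast := hstep r le_rfl
  rw [hτ.value_zero, hτ.value_last] at hlast
  exact Nat.add_le_add_iff_left.1 (hlast.trans (finrank_fullSpan_le (h.mem_p 0 le_rfl)))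

theorem epoch_count_eq_zero_iff (h : B.IsSolution p μ)
    (hτ : IsStaircase (fun t => B.activeSpan (p t)) B.fullSpan r S τ) :
    r = 0 ↔ B.zeroInfo (p 0) = ∅ := by
  rw [zeroInfo_eq_empty_iff (h.mem_p 0 le_rfl), ← hτ.value_zero]
  refine ⟨fun hr => hr ▸ hτ.value_last, fun hfull => not_not.1 fun hr => ?_⟩
  exact (hτ.value_lt_last 0 (Nat.pos_of_ne_zero hr)).ne hfull

theorem zeroInfo_nonempty (h : B.IsSolution p μ)
    (hτ : IsStaircase (fun t => B.activeSpan (p t)) B.fullSpan r S τ) {l : ℕ} (hl : l < r)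
    {t : ℝ} (ht : t ∈ Ioc (τ l) (τ (l + 1))) : (B.zeroInfo (p t)).Nonempty := by
  rw [nonempty_iff_ne_empty, Ne, zeroInfo_eq_empty_iff (h.mem_p t
    ((hτ.time_nonneg l).trans ht.1.le)), hτ.eq_of_mem_Ioc l hl t ht]
  exact (hτ.value_lt_last l hl).ne

theorem time_sub_le_timeS (h : B.IsSolution p μ) (hM : B.IsGradientBound M)
    (hτ : IsStaircase (fun t => B.activeSpan (p t)) B.fullSpan r S τ) :
    ∀ l < r, τ (l + 1) - τ l ≤ B.timeS M (S l) := by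
  intro l hl
  have hS := hτ.value_lt_last l hl
  obtain ⟨x, hx⟩ : ∃ x, B.delta x ∉ S l := by
    rw [← hτ.apply_time l hl] at hS ⊢
    exact exists_delta_notMem (h.mem_p _ (hτ.time_nonneg _)) hS
  exact h.sub_le_timeS hM hS hx (hτ.time_nonneg l) fun t ht =>
    hτ.eq_of_mem_Ioc l hl t (Ioo_subset_Ioc_self ht)

theorem activeSpan_eq_fullSpan_of_timeStar_le (h : B.IsSolution p μ) (hM : B.IsGradientBound M)
    (hτ : IsStaircase (fun t => B.activeSpan (p t)) B.fullSpan r S τ) {t : ℝ}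
    (ht : B.timeStar M r S ≤ t) : 0 ≤ t ∧ B.activeSpan (p t) = B.fullSpan := by
  have hsum : τ r + r * Real.log 2 ≤ B.timeStar M r S := by
    rw [timeStar, Finset.sum_add_distrib, Finset.sum_const, Finset.card_range, nsmul_eq_mul,
      add_le_add_iff_right, ← sub_zero (τ r), ← hτ.time_zero, ← Finset.sum_range_sub τ]
    exact Finset.sum_le_sum fun l hl => h.time_sub_le_timeS hM hτ l (Finset.mem_range.1 hl)
  have hle : τ r + r * Real.log 2 ≤ t := hsum.trans ht
  have ht0 : 0 ≤ t := (add_nonneg (hτ.time_nonneg r) (by positivity)).trans hle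
  refine ⟨ht0, ?_⟩
  rcases Nat.eq_zero_or_pos r with rfl | hr
  · refine (activeSpan_le_fullSpan _).antisymm ?_
    rw [← hτ.value_last, hτ.value_zero]
    exact h.activeSpan_le le_rfl ht0
  · have : 0 < r * Real.log 2 := mul_pos (Nat.cast_pos.2 hr) (Real.log_pos one_lt_two)
    exact hτ.eq_of_lt t (by linarith)

end IsSolution

theorem exists_timeStar_le (B : LinearBandit K d) (M : ℝ) :
    ∃ T, ∀ p μ, B.IsSolution p μ → ∀ r S τ,
      IsStaircase (fun t => B.activeSpan (p t)) B.fullSpan r S τ → B.timeStar M r S ≤ T := by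
  obtain ⟨C, hC⟩ := (finite_range fun s : Set (Fin K) =>
    B.timeS M (Submodule.span ℝ (B.a '' s)) + Real.log 2).bddAbove
  refine ⟨Module.finrank ℝ B.fullSpan * max C 0, fun p μ h r S τ hτ => ?_⟩
  have hterm : ∀ l < r, B.timeS M (S l) + Real.log 2 ≤ max C 0 := fun l hl => by
    rw [← hτ.apply_time l hl]
    exact le_max_of_le_left (hC ⟨{i | 0 < p (τ (l + 1)) i}, rfl⟩)
  calc B.timeStar M r S
      ≤ r * max C 0 := by
        simpa only [nsmul_eq_mul, Finset.card_range] using!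
          Finset.sum_le_card_nsmul _ _ _ fun l hl => hterm l (Finset.mem_range.1 hl)
    _ ≤ Module.finrank ℝ B.fullSpan * max C 0 := by
        gcongr
        exact (h.epoch_count_le hτ).trans B.finrank_span_delta_le

theorem exists_forall_activeSpan_eq_fullSpan (B : LinearBandit K d) :
    ∃ T, 0 ≤ T ∧ ∀ p μ, B.IsSolution p μ → ∀ t ≥ T, B.activeSpan (p t) = B.fullSpan := by
  obtain ⟨M, hM⟩ := B.exists_isGradientBound
  obtain ⟨T, hT⟩ := B.exists_timeStar_le M
  refine ⟨max T 0, le_max_right _ _, fun p μ h t ht => ?_⟩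
  obtain ⟨r, S, τ, hτ⟩ := h.exists_isStaircase
  exact (h.activeSpan_eq_fullSpan_of_timeStar_le hM hτ <|
    (hT p μ h r S τ hτ).trans ((le_max_left _ _).trans ht)).2

end Epochs

section Convergence

variable {K d : ℕ} {B : LinearBandit K d} {M : ℝ}

theorem isNash_iff {p : Fin K → ℝ} {μ : B.Scenario → ℝ} : B.IsNash p μ ↔
    p ∈ stdSimplex ℝ (Fin K) ∧ μ ∈ stdSimplex ℝ B.Scenario ∧
      IsMaxOn (mixedEnergy B.slice μ) (stdSimplex ℝ (Fin K)) p ∧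
      IsMinOn (fun ν => mixedEnergy B.slice ν p) (stdSimplex ℝ B.Scenario) μ := by
  refine and_congr_right fun hp => and_congr_right fun _ => and_congr
    (forall₂_congr fun q hq => ?_) (forall₂_congr fun ν _ => ?_)
  · rw [F_eq_mixedEnergy hq.1, F_eq_mixedEnergy hp.1]
    rfl
  · rw [F_eq_mixedEnergy hp.1, F_eq_mixedEnergy hp.1]
    rfl

theorem exists_isNash [Nonempty B.Scenario] : ∃ p μ, B.IsNash p μ := by
  have : Nonempty (Fin K) := ⟨B.best⟩
  obtain ⟨p, hp, μ, hμ, hmax, hmin⟩ := exists_isSaddlePoint_mixedEnergy (slice_nonempty (B := B))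
  exact ⟨p, μ, isNash_iff.2 ⟨hp, hμ, hmax, hmin⟩⟩

theorem IsNash.abs_F_sub_le_dualityGap {p pstar : Fin K → ℝ} {μ mustar : B.Scenario → ℝ}
    {y : B.Scenario → Fin K → ℝ} (hnash : B.IsNash pstar mustar) (hp : p ∈ stdSimplex ℝ (Fin K))
    (hμ : μ ∈ stdSimplex ℝ B.Scenario) (hy : ∀ x, IsEnergyMinimizer (B.slice x) p (y x)) :
    |B.F p μ - B.F pstar mustar| ≤ dualityGap B.slice p μ y := by
  obtain ⟨hpstar, hmustar, hmax, hmin⟩ := isNash_iff.1 hnash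
  rw [F_eq_mixedEnergy hp.1, F_eq_mixedEnergy hpstar.1]
  exact abs_mixedEnergy_sub_le_dualityGap hp hμ hpstar hmustar hmax hmin hy

namespace IsSolution

variable {p : ℝ → Fin K → ℝ} {μ : ℝ → B.Scenario → ℝ} {s t : ℝ}

theorem isBestReplyPath (h : B.IsSolution p μ) (hs : 0 ≤ s) (hst : s ≤ t)
    (hfull : ∀ r ≥ s, B.activeSpan (p r) = B.fullSpan) {y : ℝ → B.Scenario → Fin K → ℝ}
    (hy : ∀ r ≥ s, ∀ x, IsRegularMinimizer (B.slice x) (p r) (y r x)) :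
    IsBestReplyPath B.slice p μ y s t where
  le := hst
  nonneg_left r hr := (h.mem_p r (hs.trans hr.1)).1
  nonneg_right r hr := (h.mem_mu r (hs.trans hr.1)).1
  isRegularMinimizer r hr := hy r hr.1
  absolutelyContinuous_left := (h.absolutelyContinuousOnInterval hs hst).1
  absolutelyContinuous_right := (h.absolutelyContinuousOnInterval hs hst).2
  ae_hasDerivAt := by
    filter_upwards [h.ae_hasDerivAt] with r hr hmem
    have hr0 : 0 < r := hs.trans_lt hmem.1
    have hp := (h.mem_p r hr0.le).1
    obtain ⟨q, hq, ν, hν, hd⟩ := hr hr0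
    refine ⟨q, ν, ⟨LMOp_subset_stdSimplex _ _ hq, hν.1,
      isMaxOn_of_mem_LMOp hp (hfull r hmem.1.le) (hy r hmem.1.le) hq, ?_⟩, hd⟩
    simpa only [← D_eq_minEnergy hp] using isMinOn_of_mem_LMOmu hν

theorem abs_F_sub_le (h : B.IsSolution p μ) (hM : B.IsGradientBound M) {pstar : Fin K → ℝ}
    {mustar : B.Scenario → ℝ} (hnash : B.IsNash pstar mustar) (hs : 0 ≤ s) (hst : s ≤ t)
    (hfull : ∀ r ≥ s, B.activeSpan (p r) = B.fullSpan) :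
    |B.F (p t) (μ t) - B.F pstar mustar| ≤ Real.exp (s - t) * M := by
  have : Nonempty (Fin K) := ⟨B.best⟩
  have : Nonempty B.Scenario := (exists_pos_of_mem_stdSimplex hnash.2.1).nonempty
  have hmin : ∀ r ≥ s, ∀ x, ∃ y, IsRegularMinimizer (B.slice x) (p r) y := fun r hr x =>
    exists_isRegularMinimizer (slice_nonempty x) (h.mem_p r (hs.trans hr)).1
  choose! y hy using hmin
  have hdecay := (h.isBestReplyPath hs hst hfull hy).exp_mul_dualityGap_le fun x _ =>
    eq_zero_of_mem_direction_slice (h.mem_p s hs).1 (hfull s le_rfl)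
  have hgap : dualityGap B.slice (p s) (μ s) (y s) ≤ M :=
    dualityGap_le (h.mem_p s hs).1 (h.mem_mu s hs) fun x i =>
      hM.sq_le_of_isRegularMinimizer (hy s le_rfl x) i
  calc |B.F (p t) (μ t) - B.F pstar mustar|
      ≤ dualityGap B.slice (p t) (μ t) (y t) :=
        hnash.abs_F_sub_le_dualityGap (h.mem_p t (hs.trans hst)) (h.mem_mu t (hs.trans hst))
          fun x => (hy t hst x).isEnergyMinimizer
    _ ≤ Real.exp (s - t) * dualityGap B.slice (p s) (μ s) (y s) := by
        rwa [Real.exp_sub, div_mul_eq_mul_div, le_div_iff₀' (Real.exp_pos t)]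
    _ ≤ Real.exp (s - t) * M := by gcongr

end IsSolution

theorem exists_forall_abs_F_sub_le {pstar : Fin K → ℝ} {mustar : B.Scenario → ℝ}
    (hnash : B.IsNash pstar mustar) {ε : ℝ} (hε : 0 < ε) :
    ∃ T, ∀ p μ, B.IsSolution p μ → ∀ t ≥ T, |B.F (p t) (μ t) - B.F pstar mustar| ≤ ε := by
  obtain ⟨M, hM⟩ := B.exists_isGradientBound
  obtain ⟨s, hs, hfull⟩ := B.exists_forall_activeSpan_eq_fullSpan
  have hlim : Tendsto (fun t => Real.exp (s - t) * M) atTop (𝓝 0) := by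
    have hsub : Tendsto (fun t => s - t) atTop atBot := by
      simpa only [sub_eq_add_neg] using tendsto_atBot_add_const_left _ s tendsto_neg_atTop_atBot
    simpa only [zero_mul, Function.comp_def] using (Real.tendsto_exp_atBot.comp hsub).mul_const M
  obtain ⟨T, hT⟩ := eventually_atTop.1 (hlim.eventually_le_const hε)
  exact ⟨max s T, fun p μ h t ht => (h.abs_F_sub_le hM hnash hs ((le_max_left _ _).trans ht)
    (hfull p μ h)).trans (hT t ((le_max_right _ _).trans ht))⟩

end Convergence

end LinearBandit

theorem theorem5 {K d : ℕ} (hK : 2 ≤ K) (B : LinearBandit K d) :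
    (∃ M : ℝ, B.IsGradientBound M) ∧
    (∀ M : ℝ, B.IsGradientBound M →
      ∃ Tbar : ℝ, ∀ (p : ℝ → Fin K → ℝ) (μ : ℝ → B.Scenario → ℝ), B.IsSolution p μ →
        ∃ (r : ℕ) (S : ℕ → Submodule ℝ (EuclideanSpace ℝ (Fin d))) (τ : ℕ → ℝ),
          -- the chain of spans
          S 0 = B.activeSpan (p 0) ∧ (∀ l < r, S l < S (l + 1)) ∧ S r = B.fullSpan ∧
          r ≤ Module.finrank ℝ (Submodule.span ℝ (Set.range B.delta)) ∧
          Module.finrank ℝ (Submodule.span ℝ (Set.range B.delta)) ≤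
            Module.finrank ℝ B.fullSpan ∧
          (r = 0 ↔ B.zeroInfo (p 0) = ∅) ∧
          -- the expansion times and the epochs
          τ 0 = 0 ∧ 0 ≤ τ 1 ∧ (∀ l, 1 ≤ l → l < r → τ l < τ (l + 1)) ∧
          (∀ l < r, ∀ t ∈ Set.Ioc (τ l) (τ (l + 1)),
            B.activeSpan (p t) = S l ∧ (B.zeroInfo (p t)).Nonempty) ∧
          (∀ t, τ r < t → B.activeSpan (p t) = B.fullSpan) ∧
          (∀ l < r, τ (l + 1) - τ l ≤ B.timeS M (S l) + Real.log 2) ∧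
          -- after the total time
          B.timeStar M r S ≤ Tbar ∧
          (∀ t, B.timeStar M r S ≤ t →
            B.activeSpan (p t) = B.fullSpan ∧ B.zeroInfo (p t) = ∅ ∧
            (∀ x, 0 < B.D (p t) x) ∧ (p t, μ t) ∈ B.diffSet)) ∧
    -- uniform convergence of the game value
    (∃ (pstar : Fin K → ℝ) (mustar : B.Scenario → ℝ), B.IsNash pstar mustar ∧
      ∀ ε > 0, ∃ T : ℝ, ∀ (p : ℝ → Fin K → ℝ) (μ : ℝ → B.Scenario → ℝ), B.IsSolution p μ →
        ∀ t ≥ T, |B.F (p t) (μ t) - B.F pstar mustar| ≤ ε) := by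
  refine ⟨B.exists_isGradientBound, fun M hM => ?_, ?_⟩
  · obtain ⟨Tbar, hTbar⟩ := B.exists_timeStar_le M
    refine ⟨Tbar, fun p μ h => ?_⟩
    obtain ⟨r, S, τ, hτ⟩ := h.exists_isStaircase
    refine ⟨r, S, τ, hτ.value_zero, hτ.value_lt, hτ.value_last, h.epoch_count_le hτ,
      B.finrank_span_delta_le, h.epoch_count_eq_zero_iff hτ, hτ.time_zero, hτ.time_nonneg 1,
      hτ.time_lt, fun l hl t ht => ⟨hτ.eq_of_mem_Ioc l hl t ht, h.zeroInfo_nonempty hτ hl ht⟩,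
      hτ.eq_of_lt, fun l hl => ?_, hTbar p μ h r S τ hτ, fun t ht => ?_⟩
    · have hlog : 0 ≤ Real.log 2 := Real.log_nonneg one_le_two
      exact (h.time_sub_le_timeS hM hτ l hl).trans (le_add_of_nonneg_right hlog)
    · obtain ⟨ht0, hfull⟩ := h.activeSpan_eq_fullSpan_of_timeStar_le hM hτ ht
      have hp := h.mem_p t ht0
      exact ⟨hfull, (LinearBandit.zeroInfo_eq_empty_iff hp).2 hfull,
        LinearBandit.D_pos hp.1 hfull, LinearBandit.mem_diffSet hp (h.mem_mu t ht0) hfull⟩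
  · have : Nontrivial (Fin K) := Fin.nontrivial_iff_two_le.2 hK
    have : Nonempty B.Scenario := nonempty_subtype.2 (exists_ne B.best)
    obtain ⟨pstar, mustar, hnash⟩ := LinearBandit.exists_isNash (B := B)
    exact ⟨pstar, mustar, hnash, fun ε hε => LinearBandit.exists_forall_abs_F_sub_le hnash hε⟩
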